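/- Let $a<b<c$ be natural numbers with $\gcd(a,b,c)=1$ such that the numbers $a^pb^qc^l$, $(p,q,l)\in\mathbb{N}_0^3$, are pairwise distinct (this forces $a>1$, and it holds for instance when $a>1$ and $a,b,c$ are pairwise coprime). Put $$N_{a,b,c}(x)=\#\{(p,q,l)\in\mathbb{N}_0^3 : a^pb^qc^l\le x\},\qquad S_{a,b,c}=\{a^pb^qc^l : p,q,l\in\mathbb{N}_0\},$$ let $\chi_{S_{a,b,c}}$ be the characteristic function of $S_{a,b,c}$, and let $B_1^*(\{y\})=\{y\}-\frac12$ if $y\notin\mathbb{Z}$ and $B_1^*(\{y\})=0$ if $y\in\mathbb{Z}$, where $\{y\}$ is the fractional part of $y$. Then for every real $x\ge 1$ $$\begin{aligned} N_{a,b,c}(x)={}&\frac{\log(x)^3}{6\log a\log b\log c}+\frac{\log(x)^2}{4\log a\log b}+\frac{\log(x)^2}{4\log a\log c}+\frac{\log(x)^2}{4\log b\log c}\\ &+\frac{\log x}{4\log a}+\frac{\log x}{4\log b}+\frac{\log x}{4\log c}+\frac{\log a\log x}{12\log b\log c}+\frac{\log b\log x}{12\log a\log c}+\frac{\log c\log x}{12\log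 a\log b}\\ &+\frac{\log a}{24\log b}+\frac{\log a}{24\log c}+\frac{\log b}{24\log a}+\frac{\log b}{24\log c}+\frac{\log c}{24\log a}+\frac{\log c}{24\log b}+\frac18\\ &-B_1^*\left(\left\{\tfrac{\log x}{\log a}\right\}\right)-B_1^*\left(\left\{\tfrac{\log x}{\log b}\right\}\right)-B_1^*\left(\left\{\tfrac{\log x}{\log c}\right\}\right)\\ &-\frac{1}{4\pi}\bigl(C_{a,b}+C_{b,c}+C_{a,c}\bigr)-\frac{1}{8\pi}D+\frac12\chi_{S_{a,b,c}}(x). \end{aligned}$$ Here the series $C_{u,v}$ and $D$ are the limits $$C_{u,v}=\lim_{R\to\infty}\left(\sum_{k=1}^{\lfloor R\log u\rfloor}\frac{\cos\left(2\pi k\frac{\log x-\frac12\log v}{\log u}\right)}{k\sin\left(\frac{\pi k\log v}{\log u}\right)}+\sum_{k=1}^{\lfloor R\log v\rfloor}\frac{\cos\left(2\pi k\frac{\log x-\frac12\log u}{\log v}\right)}{k\sin\left(\frac{\pi k\log u}{\log v}\right)}\right),$$ $$D=\lim_{R\to\infty}\bigl(D_{a;b,c}(R)+D_{b;a,c}(R)+D_{c;a,b}(R)\bigr),$$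 $$D_{u;v,w}(R)=\sum_{k=1}^{\lfloor R\log u\rfloor}\frac{\sin\left(2\pi k\frac{\log x+\frac12\log v-\frac12\log w}{\log u}\right)+\sin\left(2\pi k\frac{\log x-\frac12\log v+\frac12\log w}{\log u}\right)}{k\sin\left(\frac{\pi k\log v}{\log u}\right)\sin\left(\frac{\pi k\log w}{\log u}\right)}.$$ All these limits exist when $R\to\infty$ in the following manner: for every fixed $\delta$ with $0<\delta<\frac16$, the real numbers $R$ for which $R\log a$, $R\log b$ and $R\log c$ all have distance at least $\delta$ from the nearest integer are unbounded above, the limits exist as $R\to\infty$ through these $R$, and they do not depend on $\delta$. -/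

import Mathlib

open Filter Topology

noncomputable section

/-- The number of triples `(p, q, l)` of natural numbers (zero included) with
`a ^ p * b ^ q * c ^ l ≤ x`. -/
def countN (a b c : ℕ) (x : ℝ) : ℕ :=
  Set.ncard {t : ℕ × ℕ × ℕ | (a : ℝ) ^ t.1 * (b : ℝ) ^ t.2.1 * (c : ℝ) ^ t.2.2 ≤ x}

/-- The set of numbers of the form `a ^ p * b ^ q * c ^ l`, as a set of reals. -/
def smoothSet (a b c : ℕ) : Set ℝ :=
  {y : ℝ | ∃ p q l : ℕ, y = (a : ℝ) ^ p * (b : ℝ) ^ q * (c : ℝ) ^ l}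

/-- The characteristic function of `smoothSet a b c`. -/
def chiS (a b c : ℕ) (x : ℝ) : ℝ := (smoothSet a b c).indicator (fun _ => 1) x

open Classical in
/-- The function `y ↦ B₁*({y})`: it is `{y} - 1/2` if `y` is not an integer and `0` if it is. -/
def B1star (y : ℝ) : ℝ := if ∃ n : ℤ, y = n then 0 else Int.fract y - 1 / 2

/-- The partial sum over `1 ≤ k ≤ ⌊R log a⌋` of the cosine series with base `a` and second
base `b`. -/
def cosSum (x : ℝ) (a b : ℕ) (R : ℝ) : ℝ :=
  ∑ k ∈ Finset.Icc 1 ⌊R * Real.log a⌋₊,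
    Real.cos (2 * Real.pi * k * ((Real.log x - 1 / 2 * Real.log b) / Real.log a)) /
      (k * Real.sin (Real.pi * k * Real.log b / Real.log a))

/-- The partial sum of the paired cosine series of the bases `a` and `b`: both sums are cut
with the same `R`. -/
def cosPairSum (x : ℝ) (a b : ℕ) (R : ℝ) : ℝ := cosSum x a b R + cosSum x b a R

/-- The partial sum over `1 ≤ k ≤ ⌊R log a⌋` of the sine series with base `a` and the two
other bases `b` and `c`. -/
def sinSum (x : ℝ) (a b c : ℕ) (R : ℝ) : ℝ :=
  ∑ k ∈ Finset.Icc 1 ⌊R * Real.log a⌋₊,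
    (Real.sin (2 * Real.pi * k *
        ((Real.log x + 1 / 2 * Real.log b - 1 / 2 * Real.log c) / Real.log a)) /
      (k * Real.sin (Real.pi * k * Real.log b / Real.log a) *
        Real.sin (Real.pi * k * Real.log c / Real.log a)) +
     Real.sin (2 * Real.pi * k *
        ((Real.log x - 1 / 2 * Real.log b + 1 / 2 * Real.log c) / Real.log a)) /
      (k * Real.sin (Real.pi * k * Real.log b / Real.log a) *
        Real.sin (Real.pi * k * Real.log c / Real.log a)))

/-- `R → ∞` in such a manner that `R log a`, `R log b` and `R log c` all stay at distance at
least `δ` from the integers. -/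
def gapFilter (a b c : ℕ) (δ : ℝ) : Filter ℝ :=
  atTop ⊓ 𝓟 {R : ℝ | ∀ n : ℤ, δ ≤ |R * Real.log a - n| ∧ δ ≤ |R * Real.log b - n| ∧
    δ ≤ |R * Real.log c - n|}

end

/-! The proof is Perron's formula followed by a shift of the contour to the left. Let L = log x and
let αᵢ be the logarithms of the bases. The integrand `kern α L` is e^{Ls}/s times ∏ (1 - e^{-αᵢ
s})⁻¹, the generating function of the products of powers of the bases. On Re s = 1 each factor
expands in a geometric series, and 1/(2πi) ∫ e^{Ls}/s ds is the Heaviside function with value 1/2 at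
the jump. For three bases the symmetric integrals therefore converge to N(x) - χ(x)/2
(`tendsto_lineIntegral_mul_inv`, `sum_heavisideHalf_eq_countN`).

To the left, each factor is O(e^{αᵢ Re s}), so the kernel decays like e^{(L + ∑ αᵢ) Re s}. The
integral up to height T = 2πR is then the sum of the residues below that height, plus two horizontal
edges. The distance condition on R gives |sin(πRαᵢ)| ≥ 2δ, which makes these edges O(1/R)
(`tendsto_sum_residues_sub_lineIntegral`). The pole 2πik/αᵢ lies below the height exactly when |k| ≤
Rαᵢ; this explains the common cut-off R. No lower bound for the small denominators is needed,
because the series of the different bases are only ever treated together.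

The pole at 0 contributes the polynomial `residueThree`. The other poles are simple and distinct,
since injectivity of the exponent map makes the ratios of the logarithms irrational. The residues at
k and -k combine to real terms containing cotangents.

The argument is run for one, two and three bases. One base gives -B₁*, each pair gives some limit
whose value is not needed, and three bases give N - χ/2 - `residueThree`. By `cosSum_eq` and
`sinSum_eq` the series of the theorem are linear combinations of these, so their limits exist. In
the final formula the pair limits cancel between the C's and D, and the explicit B₁* terms cancel
those contained in the C's. -/

noncomputable section

/-! ### Rectangle integrals and the residue theorem for simple poles -/

/-- The integral of `f` along the boundary of the rectangle `[u, v] × [-T, T]`, traversed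
counterclockwise. -/
def rectIntegral (f : ℂ → ℂ) (u v T : ℝ) : ℂ :=
  (∫ x in u..v, f (x + (-T : ℝ) * Complex.I)) - (∫ x in u..v, f (x + (T : ℝ) * Complex.I)) +
    Complex.I * (∫ y in (-T)..T, f (v + y * Complex.I)) -
    Complex.I * (∫ y in (-T)..T, f (u + y * Complex.I))

/-- The closed rectangle `[u, v] × [-T, T]`. -/
def closedRect (u v T : ℝ) : Set ℂ := {s | u ≤ s.re ∧ s.re ≤ v ∧ -T ≤ s.im ∧ s.im ≤ T}

/-- The open rectangle `(u, v) × (-T, T)`. -/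
def openRect (u v T : ℝ) : Set ℂ := {s | u < s.re ∧ s.re < v ∧ -T < s.im ∧ s.im < T}

lemma isOpen_openRect (u v T : ℝ) : IsOpen (openRect u v T) := by
  have h1 : IsOpen {s : ℂ | u < s.re} := isOpen_lt continuous_const Complex.continuous_re
  have h2 : IsOpen {s : ℂ | s.re < v} := isOpen_lt Complex.continuous_re continuous_const
  have h3 : IsOpen {s : ℂ | -T < s.im} := isOpen_lt continuous_const Complex.continuous_im
  have h4 : IsOpen {s : ℂ | s.im < T} := isOpen_lt Complex.continuous_im continuous_const
  exact h1.inter (h2.inter (h3.inter h4))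

lemma openRect_subset_closedRect (u v T : ℝ) : openRect u v T ⊆ closedRect u v T :=
  fun _ h => ⟨h.1.le, h.2.1.le, h.2.2.1.le, h.2.2.2.le⟩

lemma bottom_mem {u v T x : ℝ} (huv : u ≤ v) (hT : 0 ≤ T) (hx : x ∈ Set.uIcc u v) :
    (x + (-T : ℝ) * Complex.I : ℂ) ∈ closedRect u v T \ openRect u v T := by
  rw [Set.uIcc_of_le huv] at hx
  refine ⟨⟨?_, ?_, ?_, ?_⟩, fun h => ?_⟩
  · simpa using hx.1
  · simpa using hx.2
  · simp
  · simp; linarith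
  · have := h.2.2.1; simp at this

lemma top_mem {u v T x : ℝ} (huv : u ≤ v) (hT : 0 ≤ T) (hx : x ∈ Set.uIcc u v) :
    (x + (T : ℝ) * Complex.I : ℂ) ∈ closedRect u v T \ openRect u v T := by
  rw [Set.uIcc_of_le huv] at hx
  refine ⟨⟨?_, ?_, ?_, ?_⟩, fun h => ?_⟩
  · simpa using hx.1
  · simpa using hx.2
  · simp; linarith
  · simp
  · have := h.2.2.2; simp at this

lemma right_mem {u v T y : ℝ} (huv : u ≤ v) (hT : 0 ≤ T) (hy : y ∈ Set.uIcc (-T) T) :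
    (v + y * Complex.I : ℂ) ∈ closedRect u v T \ openRect u v T := by
  rw [Set.uIcc_of_le (by linarith)] at hy
  refine ⟨⟨?_, ?_, ?_, ?_⟩, fun h => ?_⟩
  · simpa using huv
  · simp
  · simpa using hy.1
  · simpa using hy.2
  · have := h.2.1; simp at this

lemma left_mem {u v T y : ℝ} (huv : u ≤ v) (hT : 0 ≤ T) (hy : y ∈ Set.uIcc (-T) T) :
    (u + y * Complex.I : ℂ) ∈ closedRect u v T \ openRect u v T := by
  rw [Set.uIcc_of_le (by linarith)] at hy
  refine ⟨⟨?_, ?_, ?_, ?_⟩, fun h => ?_⟩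
  · simp
  · simpa using huv
  · simpa using hy.1
  · simpa using hy.2
  · have := h.1; simp at this

lemma rectIntegral_congr {f g : ℂ → ℂ} {u v T : ℝ} (huv : u ≤ v) (hT : 0 ≤ T)
    (h : Set.EqOn f g (closedRect u v T \ openRect u v T)) :
    rectIntegral f u v T = rectIntegral g u v T := by
  unfold rectIntegral
  congr 1
  · congr 1
    · congr 1
      · exact intervalIntegral.integral_congr fun x hx => h (bottom_mem huv hT hx)
      · exact intervalIntegral.integral_congr fun x hx => h (top_mem huv hT hx)
    · congr 1
      exact intervalIntegral.integral_congr fun x hx => h (right_mem huv hT hx)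
  · congr 1
    exact intervalIntegral.integral_congr fun x hx => h (left_mem huv hT hx)

lemma rectIntegral_add {f g : ℂ → ℂ} {u v T : ℝ} (huv : u ≤ v) (hT : 0 ≤ T)
    (hf : ContinuousOn f (closedRect u v T \ openRect u v T))
    (hg : ContinuousOn g (closedRect u v T \ openRect u v T)) :
    rectIntegral (fun s => f s + g s) u v T = rectIntegral f u v T + rectIntegral g u v T := by
  have hb : ∀ {f : ℂ → ℂ}, ContinuousOn f (closedRect u v T \ openRect u v T) →
      IntervalIntegrable (fun x : ℝ => f (x + (-T : ℝ) * Complex.I)) MeasureTheory.volume u v :=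
    fun hf => (hf.comp (by fun_prop) fun x hx => bottom_mem huv hT hx).intervalIntegrable
  have ht : ∀ {f : ℂ → ℂ}, ContinuousOn f (closedRect u v T \ openRect u v T) →
      IntervalIntegrable (fun x : ℝ => f (x + (T : ℝ) * Complex.I)) MeasureTheory.volume u v :=
    fun hf => (hf.comp (by fun_prop) fun x hx => top_mem huv hT hx).intervalIntegrable
  have hr : ∀ {f : ℂ → ℂ}, ContinuousOn f (closedRect u v T \ openRect u v T) →
      IntervalIntegrable (fun y : ℝ => f (v + y * Complex.I)) MeasureTheory.volume (-T) T :=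
    fun hf => (hf.comp (by fun_prop) fun x hx => right_mem huv hT hx).intervalIntegrable
  have hl : ∀ {f : ℂ → ℂ}, ContinuousOn f (closedRect u v T \ openRect u v T) →
      IntervalIntegrable (fun y : ℝ => f (u + y * Complex.I)) MeasureTheory.volume (-T) T :=
    fun hf => (hf.comp (by fun_prop) fun x hx => left_mem huv hT hx).intervalIntegrable
  unfold rectIntegral
  rw [intervalIntegral.integral_add (hb hf) (hb hg), intervalIntegral.integral_add (ht hf) (ht hg),
    intervalIntegral.integral_add (hr hf) (hr hg), intervalIntegral.integral_add (hl hf) (hl hg)]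
  ring

lemma rectIntegral_const_mul (c : ℂ) (f : ℂ → ℂ) (u v T : ℝ) :
    rectIntegral (fun s => c * f s) u v T = c * rectIntegral f u v T := by
  unfold rectIntegral
  simp only [intervalIntegral.integral_const_mul]
  ring

lemma rectIntegral_sum {κ : Type*} (J : Finset κ) (f : κ → ℂ → ℂ) {u v T : ℝ} (huv : u ≤ v)
    (hT : 0 ≤ T) (hf : ∀ j ∈ J, ContinuousOn (f j) (closedRect u v T \ openRect u v T)) :
    rectIntegral (fun s => ∑ j ∈ J, f j s) u v T = ∑ j ∈ J, rectIntegral (f j) u v T := by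
  classical
  induction J using Finset.induction_on with
  | empty => simp [rectIntegral]
  | insert a J ha ih =>
    simp only [Finset.sum_insert ha]
    rw [rectIntegral_add huv hT (hf a (Finset.mem_insert_self _ _))
      (continuousOn_finsetSum _ fun j hj => hf j (Finset.mem_insert_of_mem hj)),
      ih fun j hj => hf j (Finset.mem_insert_of_mem hj)]

lemma rectIntegral_eq_zero_of_differentiableAt {f : ℂ → ℂ} {u v T : ℝ} (huv : u ≤ v) (hT : 0 ≤ T)
    (hf : ∀ s ∈ closedRect u v T, DifferentiableAt ℂ f s) : rectIntegral f u v T = 0 := by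
  have := Complex.integral_boundary_rect_eq_zero_of_differentiableOn f
    (u + (-T : ℝ) * Complex.I) (v + (T : ℝ) * Complex.I) (by
      intro s hs
      refine (hf s ?_).differentiableWithinAt
      rw [Complex.mem_reProdIm] at hs
      simp only [Complex.add_re, Complex.ofReal_re, Complex.mul_re, Complex.I_re, mul_zero,
        Complex.ofReal_im, Complex.I_im, mul_one, sub_self, add_zero, Complex.add_im,
        Complex.mul_im, zero_add] at hs
      rw [Set.uIcc_of_le huv, Set.uIcc_of_le (by linarith)] at hs
      exact ⟨hs.1.1, hs.1.2, hs.2.1, hs.2.2⟩)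
  simp only [Complex.add_re, Complex.ofReal_re, Complex.mul_re, Complex.I_re, mul_zero,
        Complex.ofReal_im, Complex.I_im, mul_one, sub_self, add_zero, Complex.add_im,
        Complex.mul_im, zero_add, smul_eq_mul] at this
  exact this

lemma hasDerivAt_comp_add_const {G : ℂ → ℂ} {d c : ℂ} {x : ℝ} (h : HasDerivAt G d (x + c)) :
    HasDerivAt (fun x : ℝ => G (x + c)) d x := by
  have h1 : HasDerivAt (fun x : ℝ => (x + c : ℂ)) 1 x :=
    (Complex.ofRealCLM.hasDerivAt (x := x)).add_const c
  have h2 := HasDerivAt.comp x (h₂ := G) (h := fun x : ℝ => (x + c : ℂ)) h h1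
  rw [mul_one] at h2
  exact h2

lemma hasDerivAt_comp_const_add_mul_I {G : ℂ → ℂ} {d c : ℂ} {y : ℝ}
    (h : HasDerivAt G d (c + y * Complex.I)) :
    HasDerivAt (fun y : ℝ => G (c + y * Complex.I)) (Complex.I * d) y := by
  have h1 : HasDerivAt (fun y : ℝ => (c + y * Complex.I : ℂ)) Complex.I y := by
    have := ((Complex.ofRealCLM.hasDerivAt (x := y)).mul_const Complex.I).const_add c
    simpa using this
  have h2 := HasDerivAt.comp y (h₂ := G) (h := fun y : ℝ => (c + y * Complex.I : ℂ)) h h1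
  rw [mul_comm] at h2
  exact h2

/-- The fundamental theorem of calculus on the four edges, whose corner values cancel. A primitive
is required only on the boundary, so `f` may be singular inside. -/
lemma rectIntegral_eq_zero_of_hasDerivAt {f G : ℂ → ℂ} {u v T : ℝ} (huv : u ≤ v) (hT : 0 ≤ T)
    (hf : ContinuousOn f (closedRect u v T \ openRect u v T))
    (hG : ∀ s ∈ closedRect u v T \ openRect u v T, HasDerivAt G (f s) s) :
    rectIntegral f u v T = 0 := by
  unfold rectIntegral
  have e1 : (∫ x in u..v, f (x + (-T : ℝ) * Complex.I)) =
      G (v + (-T : ℝ) * Complex.I) - G (u + (-T : ℝ) * Complex.I) := by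
    refine intervalIntegral.integral_eq_sub_of_hasDerivAt
      (f := fun x : ℝ => G (x + (-T : ℝ) * Complex.I)) (fun x hx => ?_)
      (hf.comp (by fun_prop) fun x hx => bottom_mem huv hT hx).intervalIntegrable
    exact hasDerivAt_comp_add_const (hG _ (bottom_mem huv hT hx))
  have e2 : (∫ x in u..v, f (x + (T : ℝ) * Complex.I)) =
      G (v + (T : ℝ) * Complex.I) - G (u + (T : ℝ) * Complex.I) := by
    refine intervalIntegral.integral_eq_sub_of_hasDerivAt
      (f := fun x : ℝ => G (x + (T : ℝ) * Complex.I)) (fun x hx => ?_)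
      (hf.comp (by fun_prop) fun x hx => top_mem huv hT hx).intervalIntegrable
    exact hasDerivAt_comp_add_const (hG _ (top_mem huv hT hx))
  have e3 : Complex.I * (∫ y in (-T)..T, f (v + y * Complex.I)) =
      G (v + (T : ℝ) * Complex.I) - G (v + (-T : ℝ) * Complex.I) := by
    rw [← intervalIntegral.integral_const_mul]
    refine intervalIntegral.integral_eq_sub_of_hasDerivAt
      (f := fun y : ℝ => G (v + y * Complex.I)) (fun x hx => ?_)
      ((hf.comp (by fun_prop) fun x hx => right_mem huv hT hx).intervalIntegrable.const_mul _)
    exact hasDerivAt_comp_const_add_mul_I (hG _ (right_mem huv hT hx))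
  have e4 : Complex.I * (∫ y in (-T)..T, f (u + y * Complex.I)) =
      G (u + (T : ℝ) * Complex.I) - G (u + (-T : ℝ) * Complex.I) := by
    rw [← intervalIntegral.integral_const_mul]
    refine intervalIntegral.integral_eq_sub_of_hasDerivAt
      (f := fun y : ℝ => G (u + y * Complex.I)) (fun x hx => ?_)
      ((hf.comp (by fun_prop) fun x hx => left_mem huv hT hx).intervalIntegrable.const_mul _)
    exact hasDerivAt_comp_const_add_mul_I (hG _ (left_mem huv hT hx))
  rw [e1, e2, e3, e4]
  ring

/-- The branch log(s - w) is a primitive on the right, top and bottom edges. The left edge crosses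
its cut, so log(-(s - w)) is used there; the two branches differ by ∓πi at the two left corners,
which adds up to 2πi. -/
lemma rectIntegral_inv_sub {u v T : ℝ} {w : ℂ} (hw : w ∈ openRect u v T) :
    rectIntegral (fun s => (s - w)⁻¹) u v T = 2 * Real.pi * Complex.I := by
  obtain ⟨hw1, hw2, hw3, hw4⟩ := hw
  have hlog : ∀ (s : ℂ), s - w ∈ Complex.slitPlane →
      HasDerivAt (fun s => Complex.log (s - w)) (s - w)⁻¹ s := fun s hs => by
    simpa using ((hasDerivAt_id s).sub_const w).clog hs
  have hlog' : ∀ (s : ℂ), -(s - w) ∈ Complex.slitPlane →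
      HasDerivAt (fun s => Complex.log (-(s - w))) (s - w)⁻¹ s := fun s hs => by
    have := ((hasDerivAt_id s).sub_const w).neg.clog hs
    have e : (s - w)⁻¹ = -1 / -(s - w) := by rw [neg_div_neg_eq, one_div]
    rw [e]
    exact this
  have hci : ∀ (γ : ℝ → ℂ) (a b : ℝ), Continuous γ → (∀ x, γ x - w ≠ 0) →
      IntervalIntegrable (fun x => (γ x - w)⁻¹) MeasureTheory.volume a b := fun γ a b hγ h0 =>
    ((hγ.sub continuous_const).inv₀ h0).intervalIntegrable _ _
  have n1 : ∀ x : ℝ, (x + (-T : ℝ) * Complex.I : ℂ) - w ≠ 0 := fun x h => by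
    have := congrArg Complex.im h; simp at this; linarith
  have n2 : ∀ x : ℝ, (x + (T : ℝ) * Complex.I : ℂ) - w ≠ 0 := fun x h => by
    have := congrArg Complex.im h; simp at this; linarith
  have n3 : ∀ y : ℝ, (v + y * Complex.I : ℂ) - w ≠ 0 := fun x h => by
    have := congrArg Complex.re h; simp at this; linarith
  have n4 : ∀ y : ℝ, (u + y * Complex.I : ℂ) - w ≠ 0 := fun x h => by
    have := congrArg Complex.re h; simp at this; linarith
  have e1 : (∫ x in u..v, (x + (-T : ℝ) * Complex.I - w : ℂ)⁻¹) =
      Complex.log (v + (-T : ℝ) * Complex.I - w) - Complex.log (u + (-T : ℝ) * Complex.I - w) := by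
    refine intervalIntegral.integral_eq_sub_of_hasDerivAt
      (f := fun x : ℝ => Complex.log (x + (-T : ℝ) * Complex.I - w)) (fun x hx => ?_)
      (hci (fun x : ℝ => (x + (-T : ℝ) * Complex.I : ℂ)) _ _ (by fun_prop) n1)
    exact hasDerivAt_comp_add_const (G := fun s => Complex.log (s - w)) (hlog (x + (-T : ℝ) * Complex.I)
      (Complex.mem_slitPlane_iff.2 (Or.inr (by simp; linarith))))
  have e2 : (∫ x in u..v, (x + (T : ℝ) * Complex.I - w : ℂ)⁻¹) =
      Complex.log (v + (T : ℝ) * Complex.I - w) - Complex.log (u + (T : ℝ) * Complex.I - w) := by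
    refine intervalIntegral.integral_eq_sub_of_hasDerivAt
      (f := fun x : ℝ => Complex.log (x + (T : ℝ) * Complex.I - w)) (fun x hx => ?_)
      (hci (fun x : ℝ => (x + (T : ℝ) * Complex.I : ℂ)) _ _ (by fun_prop) n2)
    exact hasDerivAt_comp_add_const (G := fun s => Complex.log (s - w)) (hlog (x + (T : ℝ) * Complex.I)
      (Complex.mem_slitPlane_iff.2 (Or.inr (by simp; linarith))))
  have e3 : Complex.I * (∫ y in (-T)..T, (v + y * Complex.I - w : ℂ)⁻¹) =
      Complex.log (v + (T : ℝ) * Complex.I - w) - Complex.log (v + (-T : ℝ) * Complex.I - w) := by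
    rw [← intervalIntegral.integral_const_mul]
    refine intervalIntegral.integral_eq_sub_of_hasDerivAt
      (f := fun y : ℝ => Complex.log (v + y * Complex.I - w)) (fun x hx => ?_)
      ((hci (fun y : ℝ => (v + y * Complex.I : ℂ)) _ _ (by fun_prop) n3).const_mul _)
    exact hasDerivAt_comp_const_add_mul_I (G := fun s => Complex.log (s - w)) (hlog (v + x * Complex.I)
      (Complex.mem_slitPlane_iff.2 (Or.inl (by simp; linarith))))
  have e4 : Complex.I * (∫ y in (-T)..T, (u + y * Complex.I - w : ℂ)⁻¹) =
      Complex.log (-(u + (T : ℝ) * Complex.I - w)) -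
        Complex.log (-(u + (-T : ℝ) * Complex.I - w)) := by
    rw [← intervalIntegral.integral_const_mul]
    refine intervalIntegral.integral_eq_sub_of_hasDerivAt
      (f := fun y : ℝ => Complex.log (-(u + y * Complex.I - w))) (fun x hx => ?_)
      ((hci (fun y : ℝ => (u + y * Complex.I : ℂ)) _ _ (by fun_prop) n4).const_mul _)
    exact hasDerivAt_comp_const_add_mul_I (G := fun s => Complex.log (-(s - w)))
      (hlog' (u + x * Complex.I) (Complex.mem_slitPlane_iff.2 (Or.inl (by simp; linarith))))
  unfold rectIntegral
  rw [e1, e2, e3, e4]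
  have l1 : Complex.log (-(u + (T : ℝ) * Complex.I - w)) =
      Complex.log (u + (T : ℝ) * Complex.I - w) - Real.pi * Complex.I := by
    rw [Complex.log, Complex.log, norm_neg, Complex.arg_neg_eq_arg_sub_pi_of_im_pos
      (by simp; linarith)]
    push_cast; ring
  have l2 : Complex.log (-(u + (-T : ℝ) * Complex.I - w)) =
      Complex.log (u + (-T : ℝ) * Complex.I - w) + Real.pi * Complex.I := by
    rw [Complex.log, Complex.log, norm_neg, Complex.arg_neg_eq_arg_add_pi_of_im_neg
      (by simp; linarith)]
    push_cast; ring
  rw [l1, l2]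
  ring

lemma closedRect_ne {u v T : ℝ} {s w : ℂ} (hs : s ∈ closedRect u v T \ openRect u v T)
    (hw : w ∈ openRect u v T) : s - w ≠ 0 := fun h => hs.2 (by rwa [sub_eq_zero.1 h])

/-- The residue theorem for a rectangle and a function with finitely many singularities, all of
them at most simple poles. -/
theorem rectIntegral_eq_sum_residues {κ : Type*} (J : Finset κ) (w c : κ → ℂ) {u v T : ℝ}
    (huv : u ≤ v) (hT : 0 ≤ T) (hw : Set.InjOn w J) (hin : ∀ j ∈ J, w j ∈ openRect u v T)
    (f : ℂ → ℂ)
    (hd : ∀ s ∈ closedRect u v T, (∀ j ∈ J, s ≠ w j) → DifferentiableAt ℂ f s)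
    (hres : ∀ j ∈ J, Tendsto (fun s => (s - w j) * f s) (𝓝[≠] (w j)) (𝓝 (c j))) :
    rectIntegral f u v T = 2 * Real.pi * Complex.I * ∑ j ∈ J, c j := by
  classical
  induction J using Finset.induction_on generalizing f with
  | empty =>
    simpa using rectIntegral_eq_zero_of_differentiableAt huv hT fun s hs => hd s hs (by simp)
  | insert a J ha ih =>
    have haw : w a ∈ openRect u v T := hin a (Finset.mem_insert_self _ _)
    have hne : ∀ j ∈ J, w a ≠ w j := fun j hj h => ha (by
      have := hw (by simp) (by simp [hj]) h
      rwa [this])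
    -- Removing the polar part at `w a` leaves a removable singularity there. `g1` is `g` with that
    -- point filled in, so the induction hypothesis applies to `g1` and the remaining poles.
    set g : ℂ → ℂ := fun s => f s - c a * (s - w a)⁻¹ with hg
    set g1 : ℂ → ℂ := Function.update g (w a) (limUnder (𝓝[≠] (w a)) g) with hg1
    set V : Set ℂ := openRect u v T \ (J.image w : Finset ℂ) with hV
    have hVo : IsOpen V := (isOpen_openRect u v T).sdiff (Finset.finite_toSet _).isClosed
    have hVa : w a ∈ V := ⟨haw, by
      simp only [Finset.coe_image, Set.mem_image, not_exists, not_and]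
      exact fun j hj h => hne j hj h.symm⟩
    have hgd : ∀ s, s ≠ w a → DifferentiableAt ℂ f s → DifferentiableAt ℂ g s := fun s hs h =>
      h.sub (((differentiableAt_fun_id.sub_const (w a)).fun_inv (sub_ne_zero.2 hs)).const_mul (c a))
    have hg1d : DifferentiableOn ℂ g1 V := by
      refine Complex.differentiableOn_update_limUnder_of_isLittleO (hVo.mem_nhds hVa) ?_ ?_
      · rintro s ⟨⟨hs1, hs2⟩, hs3⟩
        refine (hgd s hs3 (hd s (openRect_subset_closedRect _ _ _ hs1) ?_)).differentiableWithinAt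
        intro j hj h
        rcases Finset.mem_insert.1 hj with rfl | hj
        · exact hs3 h
        · exact hs2 (by rw [Finset.coe_image]; exact ⟨j, hj, h.symm⟩)
      · have h1 : Tendsto (fun s => (s - w a) * (g s - g (w a))) (𝓝[≠] (w a)) (𝓝 0) := by
          have h2 : Tendsto (fun s => (s - w a) * f s - c a - (s - w a) * g (w a)) (𝓝[≠] (w a))
              (𝓝 (c a - c a - (w a - w a) * g (w a))) := by
            refine ((hres a (Finset.mem_insert_self _ _)).sub_const _).sub ?_
            refine Tendsto.mono_left ?_ nhdsWithin_le_nhds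
            exact Continuous.tendsto (by fun_prop) _
          rw [sub_self, sub_self, zero_mul, sub_zero] at h2
          refine h2.congr' ?_
          filter_upwards [self_mem_nhdsWithin] with s hs
          have : s - w a ≠ 0 := sub_ne_zero.2 hs
          simp only [hg]
          field_simp
        rw [Asymptotics.isLittleO_iff_tendsto']
        · refine h1.congr' ?_
          filter_upwards with s
          rw [div_inv_eq_mul, mul_comm]
        · filter_upwards [self_mem_nhdsWithin] with s hs h
          exact absurd (inv_eq_zero.1 h) (sub_ne_zero.2 hs)
    have hg1eq : ∀ s, s ≠ w a → g1 =ᶠ[𝓝 s] g := fun s hs => by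
      filter_upwards [isOpen_ne.mem_nhds hs] with t ht
      exact Function.update_of_ne ht _ _
    have hfd : ∀ s ∈ closedRect u v T \ openRect u v T, DifferentiableAt ℂ f s := fun s hs =>
      hd s hs.1 fun j hj => sub_ne_zero.1 (closedRect_ne hs (hin j hj))
    have hsplit : rectIntegral f u v T = rectIntegral g1 u v T +
        rectIntegral (fun s => c a * (s - w a)⁻¹) u v T := by
      have hc : ContinuousOn (fun s => c a * (s - w a)⁻¹) (closedRect u v T \ openRect u v T) :=
        fun s hs => ((((differentiableAt_fun_id (𝕜 := ℂ)).sub_const (w a)).fun_inv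
          (closedRect_ne hs haw)).const_mul (c a)).continuousAt.continuousWithinAt
      rw [← rectIntegral_add huv hT ?_ hc]
      · refine rectIntegral_congr huv hT fun s hs => ?_
        have := (hg1eq s (sub_ne_zero.1 (closedRect_ne hs haw))).eq_of_nhds
        simp only [this, hg]
        ring
      · intro s hs
        have hsa := sub_ne_zero.1 (closedRect_ne hs haw)
        exact ((hgd s hsa (hfd s hs)).congr_of_eventuallyEq
          (hg1eq s hsa)).continuousAt.continuousWithinAt
    rw [hsplit, rectIntegral_const_mul, rectIntegral_inv_sub haw, Finset.sum_insert ha,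
      ih (hw.mono (by simp)) (fun j hj => hin j (Finset.mem_insert_of_mem hj)) g1]
    · ring
    · intro s hs hsJ
      by_cases hsa : s = w a
      · rw [hsa]
        exact (hg1d _ hVa).differentiableAt (hVo.mem_nhds hVa)
      · refine (hgd s hsa (hd s hs ?_)).congr_of_eventuallyEq (hg1eq s hsa)
        intro j hj
        rcases Finset.mem_insert.1 hj with rfl | hj
        · exact hsa
        · exact hsJ j hj
    · intro j hj
      have hja : w j ≠ w a := (hne j hj).symm
      have h2 : Tendsto (fun s => (s - w j) * f s - (s - w j) * (c a * (s - w a)⁻¹))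
          (𝓝[≠] (w j)) (𝓝 (c j - (w j - w j) * (c a * (w j - w a)⁻¹))) := by
        refine (hres j (Finset.mem_insert_of_mem hj)).sub ?_
        refine Tendsto.mono_left ?_ nhdsWithin_le_nhds
        refine ContinuousAt.tendsto (f := fun s => (s - w j) * (c a * (s - w a)⁻¹)) ?_
        exact (continuousAt_id.sub continuousAt_const).mul (continuousAt_const.mul
          ((continuousAt_id.sub continuousAt_const).inv₀ (sub_ne_zero.2 hja)))
      rw [sub_self, zero_mul, sub_zero] at h2
      refine h2.congr' ?_
      filter_upwards [nhdsWithin_le_nhds (hg1eq (w j) hja)] with s hs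
      simp only [hs, hg]
      ring

lemma rectIntegral_inv_pow {u v T : ℝ} (hT : 0 < T) (hu : u < 0) (hv : 0 < v) (m : ℕ) :
    rectIntegral (fun s => (s ^ (m + 2))⁻¹) u v T = 0 := by
  have h0 : (0 : ℂ) ∈ openRect u v T := ⟨by simpa, by simpa, by simpa, by simpa⟩
  have hne : ∀ s ∈ closedRect u v T \ openRect u v T, s ≠ 0 := fun s hs => by
    simpa using closedRect_ne hs h0
  refine rectIntegral_eq_zero_of_hasDerivAt (G := fun s => -((m + 1 : ℂ))⁻¹ * (s ^ (m + 1))⁻¹)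
    (by linarith) hT.le ?_ ?_
  · intro s hs
    exact ((continuousAt_id.pow _).inv₀ (pow_ne_zero _ (hne s hs))).continuousWithinAt
  · intro s hs
    have hs0 := hne s hs
    have hm : (m + 1 : ℂ) ≠ 0 := by exact_mod_cast Nat.succ_ne_zero m
    have := ((hasDerivAt_pow (m + 1) s).fun_inv (pow_ne_zero _ hs0)).const_mul (-((m + 1 : ℂ))⁻¹)
    have e : -((m + 1 : ℂ))⁻¹ * (-(((m + 1 : ℕ) : ℂ) * s ^ (m + 1 - 1)) / (s ^ (m + 1)) ^ 2) =
        (s ^ (m + 2))⁻¹ := by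
      rw [Nat.add_sub_cancel]
      push_cast
      field_simp
      ring
    rwa [e] at this

/-! ### Moving the line Re s = 1 to the left and to the right -/

/-- The integral of `f` along the vertical segment from `1 - iT` to `1 + iT`, in the variable
`Im s`. -/
def lineIntegral (f : ℂ → ℂ) (T : ℝ) : ℂ := ∫ y in (-T)..T, f (1 + y * Complex.I)

lemma integral_exp_mul {A : ℝ} (hA : A ≠ 0) (a b : ℝ) :
    ∫ x in a..b, Real.exp (A * x) = (Real.exp (A * b) - Real.exp (A * a)) / A := by
  rw [intervalIntegral.integral_comp_mul_left (fun x => Real.exp x) hA, integral_exp, smul_eq_mul]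
  field_simp

lemma norm_integral_le_exp {g : ℝ → ℂ} {A M a b : ℝ} (hA : A ≠ 0) (hab : a ≤ b)
    (hg : ∀ x, a ≤ x → x ≤ b → ‖g x‖ ≤ M * Real.exp (A * x)) :
    ‖∫ x in a..b, g x‖ ≤ M * ((Real.exp (A * b) - Real.exp (A * a)) / A) := by
  rw [← integral_exp_mul hA, ← intervalIntegral.integral_const_mul]
  refine intervalIntegral.norm_integral_le_of_norm_le hab ?_
    (Continuous.intervalIntegrable (by fun_prop) _ _)
  exact Eventually.of_forall fun x hx => hg x hx.1.le hx.2

/-- If the rectangle integrals to the left of the line `Re s = 1` have a constant value and the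
integrand decays exponentially to the left, the line integral is close to that value. -/
lemma norm_sub_lineIntegral_le {f : ℂ → ℂ} {V : ℂ} {T A M M' : ℝ} (hA : 0 < A)
    (hM : 0 ≤ M)
    (hbot : ∀ x : ℝ, ‖f (x + (-T : ℝ) * Complex.I)‖ ≤ M * Real.exp (A * x))
    (htop : ∀ x : ℝ, ‖f (x + (T : ℝ) * Complex.I)‖ ≤ M * Real.exp (A * x))
    (hleft : ∀ x y : ℝ, x ≤ -1 → ‖f (x + y * Complex.I)‖ ≤ M' * Real.exp (A * x))
    (hrect : ∀ U : ℝ, 1 ≤ U → rectIntegral f (-U) 1 T = V) :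
    ‖V - Complex.I * lineIntegral f T‖ ≤ 2 * M * Real.exp A / A := by
  have hb : ∀ {g : ℝ → ℂ} {U : ℝ}, 1 ≤ U → (∀ x, ‖g x‖ ≤ M * Real.exp (A * x)) →
      ‖∫ x in (-U)..1, g x‖ ≤ M * Real.exp A / A := fun {g U} hU hg => by
    refine (norm_integral_le_exp hA.ne' (by linarith) fun x _ _ => hg x).trans ?_
    rw [mul_div_assoc]
    have : 0 < Real.exp (A * -U) := Real.exp_pos _
    rw [mul_one]
    gcongr
    linarith
  -- The second summand bounds the left edge; it vanishes as U → ∞ with T fixed, leaving the two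
  -- horizontal edges.
  have key : ∀ U : ℝ, 1 ≤ U → ‖V - Complex.I * lineIntegral f T‖ ≤
      2 * M * Real.exp A / A + M' * Real.exp (-(A * U)) * |T - -T| := by
    intro U hU
    have h1 := hb hU hbot
    have h2 := hb hU htop
    have h3 : ‖∫ y in (-T)..T, f ((-U : ℝ) + y * Complex.I)‖ ≤
        M' * Real.exp (-(A * U)) * |T - -T| := by
      refine intervalIntegral.norm_integral_le_of_norm_le_const fun y _ => ?_
      have := hleft (-U) y (by linarith)
      rwa [mul_neg] at this
    have e : V - Complex.I * lineIntegral f T =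
        (∫ x in (-U)..1, f (x + (-T : ℝ) * Complex.I)) -
        (∫ x in (-U)..1, f (x + (T : ℝ) * Complex.I)) -
        Complex.I * (∫ y in (-T)..T, f ((-U : ℝ) + y * Complex.I)) := by
      rw [← hrect U hU, rectIntegral, lineIntegral]
      push_cast
      ring
    rw [e]
    refine (norm_sub_le _ _).trans ((add_le_add (norm_sub_le _ _) le_rfl).trans ?_)
    rw [norm_mul, Complex.norm_I, one_mul]
    calc _ ≤ M * Real.exp A / A + M * Real.exp A / A + M' * Real.exp (-(A * U)) * |T - -T| := by
          gcongr
      _ = _ := by ring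
  have hlim : Tendsto (fun U : ℝ => 2 * M * Real.exp A / A + M' * Real.exp (-(A * U)) * |T - -T|)
      atTop (𝓝 (2 * M * Real.exp A / A + M' * 0 * |T - -T|)) := by
    refine tendsto_const_nhds.add (Tendsto.mul_const _ (Tendsto.const_mul _ ?_))
    exact Real.tendsto_exp_neg_atTop_nhds_zero.comp (tendsto_id.const_mul_atTop hA)
  rw [mul_zero, zero_mul, add_zero] at hlim
  refine ge_of_tendsto hlim ?_
  filter_upwards [eventually_ge_atTop 1] with U hU using key U hU

/-- If the integrand is holomorphic and decays exponentially to the right, the line integral is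
small. -/
lemma norm_lineIntegral_le {f : ℂ → ℂ} {T B M : ℝ} (hT : 0 < T) (hB : 0 < B) (hM : 0 ≤ M)
    (hd : ∀ s : ℂ, 1 ≤ s.re → DifferentiableAt ℂ f s)
    (hf : ∀ s : ℂ, 1 ≤ s.re → ‖f s‖ ≤ M / ‖s‖ * Real.exp (-B * s.re)) :
    ‖lineIntegral f T‖ ≤ 2 * M / (T * B) := by
  have hb : ∀ {U t : ℝ}, 1 ≤ U → |t| = T →
      ‖∫ x in (1:ℝ)..U, f (x + t * Complex.I)‖ ≤ M / (T * B) := fun {U t} hU ht => by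
    have h1 := norm_integral_le_exp (g := fun x => f (x + t * Complex.I)) (A := -B) (M := M / T)
      (a := 1) (b := U) (by linarith) hU (fun x hx _ => by
        refine (hf _ (by simpa using hx)).trans ?_
        have h2 : T ≤ ‖(x + t * Complex.I : ℂ)‖ := by
          have := Complex.abs_im_le_norm (x + t * Complex.I)
          simpa [ht] using this
        simp only [Complex.add_re, Complex.ofReal_re, Complex.mul_re, Complex.I_re, mul_zero,
          Complex.ofReal_im, Complex.I_im, mul_one, sub_self, add_zero]
        gcongr)
    refine h1.trans ?_
    rw [← div_div, div_eq_mul_inv (M / T)]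
    have e1 : 0 < Real.exp (-B * U) := Real.exp_pos _
    have e2 : Real.exp (-B * 1) ≤ 1 := by rw [Real.exp_le_one_iff]; linarith
    refine mul_le_mul_of_nonneg_left ?_ (by positivity)
    rw [div_neg, ← neg_div, inv_eq_one_div]
    gcongr
    linarith
  have key : ∀ U : ℝ, 1 ≤ U → ‖lineIntegral f T‖ ≤
      2 * M / (T * B) + M * Real.exp (-(B * U)) * |T - -T| := by
    intro U hU
    have h1 := hb (t := -T) hU (by rw [abs_neg, abs_of_pos hT])
    have h2 := hb (t := T) hU (abs_of_pos hT)
    have h3 : ‖∫ y in (-T)..T, f (U + y * Complex.I)‖ ≤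
        M * Real.exp (-(B * U)) * |T - -T| := by
      refine intervalIntegral.norm_integral_le_of_norm_le_const fun y _ => ?_
      refine (hf _ (by simpa using hU)).trans ?_
      have h2 : 1 ≤ ‖(U + y * Complex.I : ℂ)‖ := by
        have := Complex.re_le_norm (U + y * Complex.I)
        simp at this
        linarith
      simp only [Complex.add_re, Complex.ofReal_re, Complex.mul_re, Complex.I_re, mul_zero,
          Complex.ofReal_im, Complex.I_im, mul_one, sub_self, add_zero, neg_mul]
      gcongr
      exact div_le_self hM h2
    have e : Complex.I * lineIntegral f T =
        (∫ x in (1:ℝ)..U, f (x + (-T : ℝ) * Complex.I)) -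
        (∫ x in (1:ℝ)..U, f (x + (T : ℝ) * Complex.I)) +
        Complex.I * (∫ y in (-T)..T, f (U + y * Complex.I)) := by
      have := rectIntegral_eq_zero_of_differentiableAt (f := f) (u := 1) (v := U) hU hT.le
        fun s hs => hd s hs.1
      rw [rectIntegral] at this
      rw [lineIntegral, ← sub_eq_zero, ← neg_eq_zero, ← this]
      push_cast
      ring
    have e2 : ‖lineIntegral f T‖ = ‖Complex.I * lineIntegral f T‖ := by
      rw [norm_mul, Complex.norm_I, one_mul]
    rw [e2, e]
    refine (norm_add_le _ _).trans ((add_le_add (norm_sub_le _ _) le_rfl).trans ?_)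
    rw [norm_mul, Complex.norm_I, one_mul]
    calc _ ≤ M / (T * B) + M / (T * B) + M * Real.exp (-(B * U)) * |T - -T| := by
          gcongr
      _ = _ := by ring
  have hlim : Tendsto (fun U : ℝ => 2 * M / (T * B) + M * Real.exp (-(B * U)) * |T - -T|)
      atTop (𝓝 (2 * M / (T * B) + M * 0 * |T - -T|)) := by
    refine tendsto_const_nhds.add (Tendsto.mul_const _ (Tendsto.const_mul _ ?_))
    exact Real.tendsto_exp_neg_atTop_nhds_zero.comp (tendsto_id.const_mul_atTop hB)
  rw [mul_zero, zero_mul, add_zero] at hlim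
  refine ge_of_tendsto hlim ?_
  filter_upwards [eventually_ge_atTop 1] with U hU using key U hU

/-! ### Size of the kernel away from its poles -/

/-- Subtracting the nearest integer brings the argument into [-π/2, π/2], where Jordan's inequality
sin t ≥ 2t/π applies to its absolute value. -/
lemma two_mul_le_abs_sin_pi_mul {δ y : ℝ} (hy : ∀ n : ℤ, δ ≤ |y - n|) :
    2 * δ ≤ |Real.sin (Real.pi * y)| := by
  have h1 := hy (round y)
  have h2 : |y - round y| ≤ 1 / 2 := abs_sub_round y
  have h3 : |Real.sin (Real.pi * y)| = Real.sin (Real.pi * |y - round y|) := by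
    have e : Real.pi * y = Real.pi * (y - round y) + round y * Real.pi := by ring
    have e2 : |Real.sin (Real.pi * (y - round y))| = |Real.sin (Real.pi * |y - round y|)| := by
      rcases abs_choice (y - round y) with h | h <;> rw [h]
      rw [mul_neg, Real.sin_neg, abs_neg]
    rw [e, Real.sin_add_int_mul_pi, abs_mul, abs_zpow, abs_neg, abs_one, one_zpow, one_mul, e2,
      abs_of_nonneg]
    refine Real.sin_nonneg_of_nonneg_of_le_pi (by positivity) ?_
    nlinarith [Real.pi_pos]
  have h4 := Real.mul_le_sin (x := Real.pi * |y - round y|) (by positivity)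
    (by nlinarith [Real.pi_pos])
  rw [h3]
  have h5 : 2 / Real.pi * (Real.pi * |y - round y|) = 2 * |y - round y| := by
    field_simp
  linarith

/-- The difference of the squares of the two sides is exactly cos²θ (1 - r)². -/
lemma abs_sin_mul_le_norm_one_sub (r θ : ℝ) :
    |Real.sin θ| * (1 + r) ≤ ‖(1 : ℂ) - r * Complex.exp ((2 * θ : ℝ) * Complex.I)‖ := by
  refine abs_le_of_sq_le_sq' ?_ (norm_nonneg _) |>.2
  have h1 := Real.sin_sq_add_cos_sq θ
  rw [Complex.sq_norm, Complex.normSq_apply, mul_pow, sq_abs]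
  simp only [Complex.sub_re, Complex.one_re, Complex.sub_im, Complex.one_im,
    Complex.re_ofReal_mul, Complex.im_ofReal_mul, Complex.exp_ofReal_mul_I_re,
    Complex.exp_ofReal_mul_I_im, Real.sin_two_mul, Real.cos_two_mul']
  have h2 := sq_nonneg (Real.cos θ * (1 - r))
  refine sub_nonneg.1 (h2.trans_eq ?_)
  linear_combination -(r ^ 2 * (Real.sin θ ^ 2 + Real.cos θ ^ 2) - 1) * h1

/-- The integrand `e^{Ls} / s · ∏ (1 - e^{-αᵢ s})⁻¹`. -/
def kern {ι : Type*} [Fintype ι] (α : ι → ℝ) (L : ℝ) (s : ℂ) : ℂ :=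
  Complex.exp (L * s) / s * ∏ i, (1 - Complex.exp (-(α i * s)))⁻¹

lemma norm_kern_le {ι : Type*} [Fintype ι] (α C : ι → ℝ) (L D : ℝ) (s : ℂ)
    (hC : ∀ i, ‖(1 - Complex.exp (-(α i * s)))⁻¹‖ ≤ C i * Real.exp (α i * s.re))
    (hD : ‖s‖⁻¹ ≤ D) :
    ‖kern α L s‖ ≤ D * (∏ i, C i) * Real.exp ((L + ∑ i, α i) * s.re) := by
  have hD0 : 0 ≤ D := (inv_nonneg.2 (norm_nonneg s)).trans hD
  have h1 : ‖Complex.exp (L * s)‖ = Real.exp (L * s.re) := by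
    rw [Complex.norm_exp]; simp
  have h2 : ∏ i, ‖(1 - Complex.exp (-(α i * s)))⁻¹‖ ≤ ∏ i, (C i * Real.exp (α i * s.re)) :=
    Finset.prod_le_prod (fun _ _ => norm_nonneg _) fun i _ => hC i
  rw [kern, norm_mul, norm_prod, norm_div, h1, div_eq_mul_inv]
  calc _ ≤ Real.exp (L * s.re) * D * ∏ i, (C i * Real.exp (α i * s.re)) := by
        gcongr
    _ = _ := by
        rw [Finset.prod_mul_distrib, ← Real.exp_sum, ← Finset.sum_mul, add_mul, Real.exp_add]
        ring

/-- On the lines Im s = ±2πR one has e^{-as} = r e^{2iθ} with r = e^{-ax} and |sin θ| = |sin(πRa)| ≥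
2δ, and 1 + r ≥ r. The bound is valid for all x and decays to the left, which controls a whole
horizontal edge. -/
lemma norm_inv_one_sub_exp_le_of_gap {a R δ x t : ℝ} (hδ : 0 < δ)
    (hgap : ∀ n : ℤ, δ ≤ |R * a - n|) (ht : t = 2 * Real.pi * R ∨ t = -(2 * Real.pi * R)) :
    ‖(1 - Complex.exp (-(a * (x + t * Complex.I))))⁻¹‖ ≤ (2 * δ)⁻¹ * Real.exp (a * x) := by
  have e : Complex.exp (-(a * (x + t * Complex.I))) =
      (Real.exp (-(a * x)) : ℝ) * Complex.exp ((2 * (-(a * t / 2)) : ℝ) * Complex.I) := by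
    rw [Complex.ofReal_exp, ← Complex.exp_add]
    congr 1
    push_cast
    ring
  have h1 := abs_sin_mul_le_norm_one_sub (Real.exp (-(a * x))) (-(a * t / 2))
  have h2 : |Real.sin (-(a * t / 2))| = |Real.sin (Real.pi * (R * a))| := by
    rw [Real.sin_neg, abs_neg]
    have e1 : Real.pi * (R * a) = a * (2 * Real.pi * R) / 2 := by ring
    rw [e1]
    rcases ht with rfl | rfl
    · rfl
    · rw [mul_neg, neg_div, Real.sin_neg, abs_neg]
  have h3 := two_mul_le_abs_sin_pi_mul hgap
  have h4 : 2 * δ * Real.exp (-(a * x)) ≤ ‖1 - Complex.exp (-(a * (x + t * Complex.I)))‖ := by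
    rw [e]
    refine le_trans ?_ h1
    rw [h2]
    have := Real.exp_pos (-(a * x))
    exact mul_le_mul h3 (by linarith) this.le (abs_nonneg _)
  rw [norm_inv]
  calc _ ≤ (2 * δ * Real.exp (-(a * x)))⁻¹ := by
        gcongr
    _ = _ := by rw [mul_inv, ← Real.exp_neg, neg_neg]

/-- For z = e^{-as} one has |z| ≥ e^a here, hence |1 - z| ≥ |z| - 1 ≥ (1 - e^{-a})|z|. -/
lemma norm_inv_one_sub_exp_le_of_re_le {a : ℝ} {s : ℂ} (ha : 0 < a) (hs : s.re ≤ -1) :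
    ‖(1 - Complex.exp (-(a * s)))⁻¹‖ ≤ (1 - Real.exp (-a))⁻¹ * Real.exp (a * s.re) := by
  have h0 : Real.exp (-a) < 1 := by rw [Real.exp_lt_one_iff]; linarith
  have h1 : ‖Complex.exp (-(a * s))‖ = Real.exp (-(a * s.re)) := by
    rw [Complex.norm_exp]; simp
  have h2 : (1 - Real.exp (-a)) * Real.exp (-(a * s.re)) ≤ ‖1 - Complex.exp (-(a * s))‖ := by
    have h3 := norm_sub_norm_le (Complex.exp (-(a * s))) 1
    rw [h1, norm_one, norm_sub_rev] at h3
    refine le_trans ?_ h3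
    rw [sub_mul, one_mul, ← Real.exp_add]
    have : 1 ≤ Real.exp (-a + -(a * s.re)) := Real.one_le_exp (by nlinarith)
    linarith
  rw [norm_inv]
  calc _ ≤ ((1 - Real.exp (-a)) * Real.exp (-(a * s.re)))⁻¹ := by
        refine inv_anti₀ (mul_pos (by linarith) (Real.exp_pos _)) h2
    _ = _ := by rw [mul_inv, ← Real.exp_neg, neg_neg]

/-! ### Poles and residues of the kernel -/

/-- The pole `2πik / a` of `(1 - e^{-as})⁻¹`. -/
def kernPole (a : ℝ) (k : ℤ) : ℂ := 2 * Real.pi * k / a * Complex.I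

/-- The residue of `kern α L` at the pole `2πik / αᵢ`. -/
def kernRes {ι : Type*} [Fintype ι] [DecidableEq ι] (α : ι → ℝ) (L : ℝ) (i : ι) (k : ℤ) : ℂ :=
  Complex.exp (L * kernPole (α i) k) / (2 * Real.pi * k * Complex.I) *
    ∏ j ∈ Finset.univ.erase i, (1 - Complex.exp (-(α j * kernPole (α i) k)))⁻¹

/-- The nonzero integers of absolute value at most `⌊x⌋`. -/
def nonzeroInts (x : ℝ) : Finset ℤ := (Finset.Icc (-(⌊x⌋₊ : ℤ)) ⌊x⌋₊).erase 0

lemma mem_nonzeroInts {x : ℝ} (hx : 0 ≤ x) {k : ℤ} :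
    k ∈ nonzeroInts x ↔ k ≠ 0 ∧ |(k : ℝ)| ≤ x := by
  rw [nonzeroInts, Finset.mem_erase, Finset.mem_Icc, ← abs_le]
  refine and_congr_right fun _ => ?_
  have e : |(k : ℝ)| = (k.natAbs : ℝ) := by rw [Nat.cast_natAbs, Int.cast_abs]
  rw [e, ← Nat.le_floor_iff hx]
  rw [← Int.natCast_natAbs, Nat.cast_le]

lemma kernPole_im (a : ℝ) (k : ℤ) : (kernPole a k).im = 2 * Real.pi * k / a := by
  have : kernPole a k = ((2 * Real.pi * k / a : ℝ) : ℂ) * Complex.I := by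
    rw [kernPole]; push_cast; ring
  rw [this]; simp

lemma kernPole_re (a : ℝ) (k : ℤ) : (kernPole a k).re = 0 := by
  have : kernPole a k = ((2 * Real.pi * k / a : ℝ) : ℂ) * Complex.I := by
    rw [kernPole]; push_cast; ring
  rw [this]; simp

lemma exp_eq_one_iff_kernPole {a : ℝ} (ha : a ≠ 0) {s : ℂ} :
    Complex.exp (-(a * s)) = 1 ↔ ∃ k : ℤ, s = kernPole a k := by
  have ha' : (a : ℂ) ≠ 0 := by exact_mod_cast ha
  rw [Complex.exp_eq_one_iff]
  constructor
  · rintro ⟨n, hn⟩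
    refine ⟨-n, ?_⟩
    rw [kernPole]
    push_cast
    field_simp
    linear_combination -hn
  · rintro ⟨k, rfl⟩
    refine ⟨-k, ?_⟩
    rw [kernPole]
    push_cast
    field_simp

/-- Comparing imaginary parts gives kαⱼ = k'αᵢ, which for i ≠ j is excluded by the irrationality of
the ratio. Thus nonzero poles of different factors never coincide and all of them are simple. -/
lemma kernPole_injective_of_indep {ι : Type*} {α : ι → ℝ} (hα : ∀ i, 0 < α i)
    (hirr : ∀ i j, i ≠ j → ∀ k k' : ℤ, k * α j = k' * α i → k = 0)
    {i j : ι} {k k' : ℤ} (hk : k ≠ 0) (h : kernPole (α i) k = kernPole (α j) k') :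
    i = j ∧ k = k' := by
  have h1 := congrArg Complex.im h
  rw [kernPole_im, kernPole_im, div_eq_div_iff (hα i).ne' (hα j).ne'] at h1
  have h2 : k * α j = k' * α i := by
    have := Real.pi_pos
    have h3 : 2 * Real.pi * (k * α j - k' * α i) = 0 := by linear_combination h1
    rcases mul_eq_zero.1 h3 with h | h
    · exact absurd h (by positivity)
    · linarith
  by_cases hij : i = j
  · subst hij
    refine ⟨rfl, ?_⟩
    exact_mod_cast mul_right_cancel₀ (hα i).ne' h2
  · exact absurd (hirr i j hij k k' h2) hk

lemma differentiableAt_kern {ι : Type*} [Fintype ι] {α : ι → ℝ} (L : ℝ) {s : ℂ} (hs : s ≠ 0)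
    (h : ∀ i, Complex.exp (-(α i * s)) ≠ 1) : DifferentiableAt ℂ (kern α L) s := by
  unfold kern
  refine DifferentiableAt.mul ?_ ?_
  · exact DifferentiableAt.div (by fun_prop) (by fun_prop) hs
  · refine DifferentiableAt.fun_finsetProd fun i _ => ?_
    exact DifferentiableAt.fun_inv (by fun_prop) (sub_ne_zero.2 (h i).symm)

/-- The function 1 - e^{-as} vanishes at the pole with derivative a, and the expression is the
reciprocal of its difference quotient. -/
lemma tendsto_sub_mul_inv_one_sub_exp {a : ℝ} (ha : a ≠ 0) (k : ℤ) :
    Tendsto (fun s => (s - kernPole a k) * (1 - Complex.exp (-(a * s)))⁻¹)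
      (𝓝[≠] (kernPole a k)) (𝓝 (a : ℂ)⁻¹) := by
  have he : Complex.exp (-(a * kernPole a k)) = 1 := (exp_eq_one_iff_kernPole ha).2 ⟨k, rfl⟩
  have h1 : HasDerivAt (fun s : ℂ => 1 - Complex.exp (-(a * s))) a (kernPole a k) := by
    have := (((hasDerivAt_id (kernPole a k)).const_mul (a : ℂ)).neg.cexp).const_sub 1
    simp only [Pi.neg_apply, id] at this
    rw [he] at this
    simpa using this
  have h2 := (hasDerivAt_iff_tendsto_slope.1 h1).inv₀ (by exact_mod_cast ha)
  refine h2.congr fun s => ?_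
  rw [slope_def_field, he, inv_div]
  simp [div_eq_mul_inv]

/-- All factors except the i-th are continuous at the pole w. The i-th contributes 1/αᵢ, which
together with the 1/w of the kernel gives 1/(2πik). -/
lemma tendsto_kern_residue {ι : Type*} [Fintype ι] [DecidableEq ι] {α : ι → ℝ}
    (hα : ∀ i, 0 < α i) (hirr : ∀ i j, i ≠ j → ∀ k k' : ℤ, k * α j = k' * α i → k = 0) (L : ℝ)
    (i : ι) {k : ℤ} (hk : k ≠ 0) :
    Tendsto (fun s => (s - kernPole (α i) k) * kern α L s) (𝓝[≠] (kernPole (α i) k))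
      (𝓝 (kernRes α L i k)) := by
  set w := kernPole (α i) k with hw
  have hai : (α i : ℂ) ≠ 0 := by exact_mod_cast (hα i).ne'
  have hk' : (k : ℂ) ≠ 0 := by exact_mod_cast hk
  have hpi : (Real.pi : ℂ) ≠ 0 := by exact_mod_cast Real.pi_ne_zero
  have hw0 : w ≠ 0 := by
    rw [hw, kernPole]
    exact mul_ne_zero (div_ne_zero (by simp [hk', hpi]) hai) Complex.I_ne_zero
  have hc : Tendsto (fun s => Complex.exp (L * s) / s *
      ∏ j ∈ Finset.univ.erase i, (1 - Complex.exp (-(α j * s)))⁻¹) (𝓝[≠] w)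
      (𝓝 (Complex.exp (L * w) / w *
      ∏ j ∈ Finset.univ.erase i, (1 - Complex.exp (-(α j * w)))⁻¹)) := by
    refine Tendsto.mono_left (ContinuousAt.tendsto ?_) nhdsWithin_le_nhds
    refine ContinuousAt.mul (ContinuousAt.div (by fun_prop) (by fun_prop) hw0) ?_
    refine tendsto_finsetProd _ fun j hj => ?_
    refine ContinuousAt.tendsto
      (f := fun s : ℂ => (1 - Complex.exp (-(α j * s)))⁻¹) (ContinuousAt.inv₀ (by fun_prop) ?_)
    intro h0
    have h1 := (exp_eq_one_iff_kernPole (hα j).ne').1 (sub_eq_zero.1 h0).symm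
    obtain ⟨k', hk'⟩ := h1
    exact (Finset.mem_erase.1 hj).1 (kernPole_injective_of_indep hα hirr hk hk').1.symm
  have h := (tendsto_sub_mul_inv_one_sub_exp (hα i).ne' k).mul hc
  have e : (α i : ℂ)⁻¹ * (Complex.exp (L * w) / w *
      ∏ j ∈ Finset.univ.erase i, (1 - Complex.exp (-(α j * w)))⁻¹) = kernRes α L i k := by
    rw [kernRes, ← hw]
    have : (α i : ℂ) * w = 2 * Real.pi * k * Complex.I := by
      rw [hw, kernPole]; field_simp
    rw [← this]
    field_simp
  rw [e] at h
  refine h.congr fun s => ?_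
  rw [kern, ← Finset.mul_prod_erase Finset.univ _ (Finset.mem_univ i)]
  ring

/-- The residue theorem for `kern α L` on a rectangle whose horizontal edges avoid the poles. The
principal part at `0` is `∑ c m / s ^ (m + 2) + c₀ / s`. -/
theorem rectIntegral_kern {ι : Type*} [Fintype ι] [DecidableEq ι] {α : ι → ℝ}
    (hα : ∀ i, 0 < α i) (hirr : ∀ i j, i ≠ j → ∀ k k' : ℤ, k * α j = k' * α i → k = 0) (L : ℝ)
    {n : ℕ} {c : ℕ → ℂ} {c₀ : ℂ}
    (h0 : Tendsto (fun s => s * (kern α L s - ∑ m ∈ Finset.range n, c m * (s ^ (m + 2))⁻¹))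
      (𝓝[≠] 0) (𝓝 c₀))
    {R U : ℝ} (hR : 0 < R) (hU : 0 < U) (hgap : ∀ i, ∀ n : ℤ, R * α i ≠ n) :
    rectIntegral (kern α L) (-U) 1 (2 * Real.pi * R) =
      2 * Real.pi * Complex.I *
        (c₀ + ∑ i, ∑ k ∈ nonzeroInts (R * α i), kernRes α L i k) := by
  set T := 2 * Real.pi * R with hTdef
  have hT : 0 < T := by have := Real.pi_pos; positivity
  -- `g` collects the terms of order at least 2 in the principal part at 0. They have primitives, so
  -- they integrate to 0, while the difference of the kernel and `g` has at most simple poles.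
  set g : ℂ → ℂ := fun s => ∑ m ∈ Finset.range n, c m * (s ^ (m + 2))⁻¹ with hg
  have h0mem : (0 : ℂ) ∈ openRect (-U) 1 T := ⟨by simpa, by simp, by simpa, by simpa⟩
  have hgterm : ∀ m, ∀ s : ℂ, s ≠ 0 → DifferentiableAt ℂ (fun s => c m * (s ^ (m + 2))⁻¹) s :=
    fun m s hs => DifferentiableAt.const_mul
      (DifferentiableAt.fun_inv (differentiableAt_fun_id.fun_pow (m + 2)) (pow_ne_zero _ hs)) _
  have hgd : ∀ s : ℂ, s ≠ 0 → DifferentiableAt ℂ g s := fun s hs =>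
    DifferentiableAt.fun_sum fun m _ => hgterm m s hs
  have hRα : ∀ i, 0 ≤ R * α i := fun i => (mul_pos hR (hα i)).le
  have hpole : ∀ i, ∀ k ∈ nonzeroInts (R * α i), kernPole (α i) k ∈ openRect (-U) 1 T := by
    intro i k hk
    obtain ⟨hk0, hk1⟩ := (mem_nonzeroInts (hRα i)).1 hk
    -- Equality would put the pole on a horizontal edge; the gap condition forbids it.
    have hlt : |(k : ℝ)| < R * α i := by
      refine lt_of_le_of_ne hk1 fun h => ?_
      exact hgap i |k| (by rw [← h]; push_cast; rfl)
    have him : |(kernPole (α i) k).im| < T := by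
      rw [kernPole_im, abs_div, abs_mul, abs_of_pos (hα i), div_lt_iff₀ (hα i),
        abs_of_pos (by positivity : (0 : ℝ) < 2 * Real.pi), hTdef, mul_assoc (2 * Real.pi) R]
      exact mul_lt_mul_of_pos_left hlt (by positivity)
    rw [abs_lt] at him
    exact ⟨by rw [kernPole_re]; linarith, by rw [kernPole_re]; norm_num, him.1, him.2⟩
  have hkd : ∀ s ∈ closedRect (-U) 1 T, s ≠ 0 →
      (∀ i, ∀ k ∈ nonzeroInts (R * α i), s ≠ kernPole (α i) k) →
      DifferentiableAt ℂ (kern α L) s := by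
    intro s hs hs0 hsk
    refine differentiableAt_kern L hs0 fun i hi => ?_
    obtain ⟨k, rfl⟩ := (exp_eq_one_iff_kernPole (hα i).ne').1 hi
    refine hsk i k ((mem_nonzeroInts (hRα i)).2 ⟨?_, ?_⟩) rfl
    · rintro rfl
      exact hs0 (by simp [kernPole])
    · have him : |(kernPole (α i) k).im| ≤ T := abs_le.2 ⟨hs.2.2.1, hs.2.2.2⟩
      rw [kernPole_im, abs_div, abs_mul, abs_of_pos (hα i), div_le_iff₀ (hα i),
        abs_of_pos (by positivity : (0 : ℝ) < 2 * Real.pi), hTdef, mul_assoc (2 * Real.pi) R] at him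
      exact le_of_mul_le_mul_left him (by positivity)
  -- The index `none` stands for the pole at 0, which belongs to all the factors at once.
  set J : Finset (Option (Σ _ : ι, ℤ)) :=
    Finset.insertNone (Finset.univ.sigma fun i => nonzeroInts (R * α i)) with hJ
  set w : Option (Σ _ : ι, ℤ) → ℂ := fun o => o.elim 0 fun p => kernPole (α p.1) p.2 with hw
  set d : Option (Σ _ : ι, ℤ) → ℂ := fun o => o.elim c₀ fun p => kernRes α L p.1 p.2 with hd
  have hmem : ∀ i k, some (⟨i, k⟩ : Σ _ : ι, ℤ) ∈ J ↔ k ∈ nonzeroInts (R * α i) := by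
    intro i k; simp [hJ]
  have hpole0 : ∀ i, ∀ k ∈ nonzeroInts (R * α i), kernPole (α i) k ≠ 0 := by
    intro i k hk h
    have h1 := congrArg Complex.im h
    rw [kernPole_im, Complex.zero_im, div_eq_zero_iff] at h1
    have := ((mem_nonzeroInts (hRα i)).1 hk).1
    simp [Real.pi_ne_zero, this, (hα i).ne'] at h1
  have hmain := rectIntegral_eq_sum_residues J w d (u := -U) (v := 1) (T := T) (by linarith) hT.le
    (by
      rintro (_ | ⟨i, k⟩) hp (_ | ⟨j, k'⟩) hq h
      · rfl
      · exact absurd h.symm (hpole0 j k' ((hmem _ _).1 hq))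
      · exact absurd h (hpole0 i k ((hmem _ _).1 hp))
      · have := kernPole_injective_of_indep hα hirr
          ((mem_nonzeroInts (hRα i)).1 ((hmem _ _).1 hp)).1 h
        obtain ⟨h1, h2⟩ := this
        dsimp only at h1 h2
        rw [h1, h2])
    (by
      rintro (_ | ⟨i, k⟩) hp
      · exact h0mem
      · exact hpole i k ((hmem _ _).1 hp))
    (fun s => kern α L s - g s)
    (by
      intro s hs hsJ
      have hs0 : s ≠ 0 := hsJ none (by simp [hJ])
      exact (hkd s hs hs0 fun i k hk => hsJ (some ⟨i, k⟩) ((hmem _ _).2 hk)).sub (hgd s hs0))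
    (by
      rintro (_ | ⟨i, k⟩) hp
      · simpa [hw, hd] using h0
      · have hk := (hmem _ _).1 hp
        have h1 := tendsto_kern_residue hα hirr L i ((mem_nonzeroInts (hRα i)).1 hk).1
        have h2 : Tendsto (fun s => (s - kernPole (α i) k) * g s) (𝓝[≠] (kernPole (α i) k))
            (𝓝 ((kernPole (α i) k - kernPole (α i) k) * g (kernPole (α i) k))) := by
          refine Tendsto.mono_left (ContinuousAt.tendsto (ContinuousAt.mul (by fun_prop) ?_))
            nhdsWithin_le_nhds
          exact (hgd _ (hpole0 i k hk)).continuousAt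
        rw [sub_self, zero_mul] at h2
        have h3 := h1.sub h2
        rw [sub_zero] at h3
        refine h3.congr fun s => ?_
        simp only [hw, Option.elim_some]
        ring)
  have hsplit : rectIntegral (kern α L) (-U) 1 T =
      rectIntegral (fun s => kern α L s - g s) (-U) 1 T + rectIntegral g (-U) 1 T := by
    have hne : ∀ s ∈ closedRect (-U) 1 T \ openRect (-U) 1 T, s ≠ 0 := fun s hs => by
      simpa using closedRect_ne hs h0mem
    rw [← rectIntegral_add (by linarith) hT.le]
    · simp
    · intro s hs
      refine ((hkd s hs.1 (hne s hs) ?_).sub (hgd s (hne s hs))).continuousAt.continuousWithinAt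
      exact fun i k hk => sub_ne_zero.1 (closedRect_ne hs (hpole i k hk))
    · exact fun s hs => (hgd s (hne s hs)).continuousAt.continuousWithinAt
  have hgz : rectIntegral g (-U) 1 T = 0 := by
    rw [hg, rectIntegral_sum _ _ (by linarith) hT.le]
    · refine Finset.sum_eq_zero fun m _ => ?_
      rw [rectIntegral_const_mul, rectIntegral_inv_pow hT (by linarith) one_pos, mul_zero]
    · intro m _ s hs
      exact (hgterm m s (by simpa using closedRect_ne hs h0mem)).continuousAt.continuousWithinAt
  rw [hsplit, hgz, add_zero, hmain, hJ, Finset.sum_insertNone, Finset.sum_sigma]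
  simp [hd]

/-- Along `R → ∞` avoiding the poles, the sum of the residues approaches the truncated line
integral. -/
theorem tendsto_sum_residues_sub_lineIntegral {ι : Type*} [Fintype ι] [DecidableEq ι] {α : ι → ℝ}
    (hα : ∀ i, 0 < α i) (hirr : ∀ i j, i ≠ j → ∀ k k' : ℤ, k * α j = k' * α i → k = 0) {L : ℝ}
    (hL : 0 < L + ∑ i, α i) {n : ℕ} {c : ℕ → ℂ} {c₀ : ℂ}
    (h0 : Tendsto (fun s => s * (kern α L s - ∑ m ∈ Finset.range n, c m * (s ^ (m + 2))⁻¹))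
      (𝓝[≠] 0) (𝓝 c₀))
    {l : Filter ℝ} (hl : l ≤ atTop) {δ : ℝ} (hδ : 0 < δ)
    (hgap : ∀ᶠ R in l, ∀ i, ∀ n : ℤ, δ ≤ |R * α i - n|) :
    Tendsto (fun R => 2 * Real.pi * (c₀ + ∑ i, ∑ k ∈ nonzeroInts (R * α i), kernRes α L i k) -
      lineIntegral (kern α L) (2 * Real.pi * R)) l (𝓝 0) := by
  set A := L + ∑ i, α i with hA
  set C : ℝ := ∏ _i : ι, (2 * δ)⁻¹ with hC
  have hC0 : 0 ≤ C := Finset.prod_nonneg fun _ _ => by positivity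
  have hlim : Tendsto (fun R : ℝ => 2 * ((2 * Real.pi * R)⁻¹ * C) * Real.exp A / A) l (𝓝 0) := by
    have h1 : Tendsto (fun R : ℝ => 2 * ((2 * Real.pi * R)⁻¹ * C) * Real.exp A / A) atTop
        (𝓝 (2 * (0 * C) * Real.exp A / A)) := by
      refine Tendsto.div_const (Tendsto.mul_const _ (Tendsto.const_mul _ (Tendsto.mul_const _ ?_))) _
      exact tendsto_inv_atTop_zero.comp (tendsto_id.const_mul_atTop (by positivity))
    rw [zero_mul, mul_zero, zero_mul, zero_div] at h1
    exact h1.mono_left hl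
  refine squeeze_zero_norm' ?_ hlim
  filter_upwards [hgap, hl (eventually_gt_atTop 0)] with R hg hR
  have hT : 0 < 2 * Real.pi * R := by positivity
  have hhor : ∀ t : ℝ, (t = 2 * Real.pi * R ∨ t = -(2 * Real.pi * R)) → ∀ x : ℝ,
      ‖kern α L (x + t * Complex.I)‖ ≤ (2 * Real.pi * R)⁻¹ * C * Real.exp (A * x) := by
    intro t ht x
    have h1 := norm_kern_le α (fun _ => (2 * δ)⁻¹) L (2 * Real.pi * R)⁻¹ (x + t * Complex.I)
      (fun i => by
        have := norm_inv_one_sub_exp_le_of_gap (x := x) hδ (hg i) ht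
        simpa using this)
      (by
        refine inv_anti₀ hT ?_
        have h2 := Complex.abs_im_le_norm (x + t * Complex.I)
        have h3 : |t| = 2 * Real.pi * R := by
          rcases ht with rfl | rfl
          · exact abs_of_pos hT
          · rw [abs_neg, abs_of_pos hT]
        simpa [h3] using h2)
    have h2 : (x + t * Complex.I : ℂ).re = x := by simp
    rw [h2] at h1
    exact h1
  -- The factor 1 in `M'` bounds 1/|s| for Re s ≤ -1. On the horizontal edges 1/|s| ≤ 1/(2πR)
  -- supplies the decay in R.
  have key := norm_sub_lineIntegral_le (f := kern α L) (T := 2 * Real.pi * R) hL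
    (M := (2 * Real.pi * R)⁻¹ * C) (M' := 1 * ∏ i, (1 - Real.exp (-α i))⁻¹) (by positivity)
    (hhor _ (Or.inr rfl)) (hhor _ (Or.inl rfl))
    (fun x y hx => by
      have h1 := norm_kern_le α (fun i => (1 - Real.exp (-α i))⁻¹) L 1 (x + y * Complex.I)
        (fun i => norm_inv_one_sub_exp_le_of_re_le (hα i) (by simpa using hx))
        (by
          have h2 := Complex.abs_re_le_norm (x + y * Complex.I)
          refine inv_le_one_of_one_le₀ (le_trans ?_ h2)
          rw [abs_of_nonpos (by simp; linarith)]
          simp; linarith)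
      simpa using h1)
    (fun U hU => rectIntegral_kern hα hirr L h0 hR (by linarith) fun i n h => by
      have := hg i n
      rw [h, sub_self, abs_zero] at this
      linarith)
  refine le_trans (le_of_eq ?_) key
  rw [← one_mul ‖_‖, ← Complex.norm_I, ← norm_mul]
  congr 1
  ring

/-! ### Perron's formula for truncated line integrals -/

/-- The normalized Heaviside function, with value `1/2` at `0`. -/
def heavisideHalf (L : ℝ) : ℝ := if 0 < L then 1 else if L = 0 then 1 / 2 else 0

lemma lineIntegral_add {f g : ℂ → ℂ} (hf : ∀ s : ℂ, 1 ≤ s.re → DifferentiableAt ℂ f s)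
    (hg : ∀ s : ℂ, 1 ≤ s.re → DifferentiableAt ℂ g s) (T : ℝ) :
    lineIntegral (fun s => f s + g s) T = lineIntegral f T + lineIntegral g T := by
  have hi : ∀ {f : ℂ → ℂ}, (∀ s : ℂ, 1 ≤ s.re → DifferentiableAt ℂ f s) →
      IntervalIntegrable (fun y : ℝ => f (1 + y * Complex.I)) MeasureTheory.volume (-T) T := by
    intro f hf
    refine Continuous.intervalIntegrable (continuous_iff_continuousAt.2 fun y => ?_) _ _
    exact ContinuousAt.comp (f := fun y : ℝ => (1 + y * Complex.I : ℂ))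
      (hf _ (by simp)).continuousAt (by fun_prop)
  exact intervalIntegral.integral_add (hi hf) (hi hg)

lemma lineIntegral_sum {κ : Type*} (J : Finset κ) {f : κ → ℂ → ℂ}
    (hf : ∀ j ∈ J, ∀ s : ℂ, 1 ≤ s.re → DifferentiableAt ℂ (f j) s) (T : ℝ) :
    lineIntegral (fun s => ∑ j ∈ J, f j s) T = ∑ j ∈ J, lineIntegral (f j) T := by
  classical
  induction J using Finset.induction_on with
  | empty => simp [lineIntegral]
  | insert a J ha ih =>
    simp only [Finset.sum_insert ha]
    rw [lineIntegral_add (hf a (Finset.mem_insert_self _ _)), ih]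
    · exact fun j hj => hf j (Finset.mem_insert_of_mem hj)
    · exact fun s hs => DifferentiableAt.fun_sum fun j hj =>
        hf j (Finset.mem_insert_of_mem hj) s hs

lemma lineIntegral_congr {f g : ℂ → ℂ} (h : ∀ s : ℂ, s.re = 1 → f s = g s) (T : ℝ) :
    lineIntegral f T = lineIntegral g T :=
  intervalIntegral.integral_congr fun y _ => h _ (by simp)

lemma tendsto_lineIntegral_zero {f : ℂ → ℂ} {B M : ℝ} (hB : 0 < B) (hM : 0 ≤ M)
    (hd : ∀ s : ℂ, 1 ≤ s.re → DifferentiableAt ℂ f s)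
    (hf : ∀ s : ℂ, 1 ≤ s.re → ‖f s‖ ≤ M / ‖s‖ * Real.exp (-B * s.re)) :
    Tendsto (lineIntegral f) atTop (𝓝 0) := by
  have hlim : Tendsto (fun T : ℝ => 2 * M / (T * B)) atTop (𝓝 0) :=
    tendsto_const_nhds.div_atTop (tendsto_id.atTop_mul_const hB)
  refine squeeze_zero_norm' ?_ hlim
  filter_upwards [eventually_gt_atTop 0] with T hT
  exact norm_lineIntegral_le hT hB hM hd hf

/-- Averaging the values at y and -y leaves the real part 1/(1 + y²) of 1/(1 + iy). -/
lemma lineIntegral_inv (T : ℝ) : lineIntegral (fun s => 1 / s) T = (2 * Real.arctan T : ℝ) := by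
  have hne : ∀ y : ℝ, (1 + y * Complex.I : ℂ) ≠ 0 := fun y h => by
    have := congrArg Complex.re h; simp at this
  have hc : Continuous fun y : ℝ => (1 / (1 + y * Complex.I) : ℂ) :=
    continuous_const.div (by fun_prop) hne
  have hc' : Continuous fun y : ℝ => (1 / (1 + (-y : ℝ) * Complex.I) : ℂ) :=
    hc.comp continuous_neg
  have h1 : lineIntegral (fun s => 1 / s) T =
      ∫ y in (-T)..T, (1 / (1 + (-y : ℝ) * Complex.I) : ℂ) := by
    have := intervalIntegral.integral_comp_neg (a := -T) (b := T)
      (fun y : ℝ => (1 / (1 + y * Complex.I) : ℂ))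
    rw [neg_neg] at this
    rw [this, lineIntegral]
  have h2 : lineIntegral (fun s => 1 / s) T + lineIntegral (fun s => 1 / s) T =
      ∫ y in (-T)..T, (((2 : ℝ) * (1 / (1 + y ^ 2)) : ℝ) : ℂ) := by
    nth_rewrite 2 [h1]
    rw [lineIntegral, ← intervalIntegral.integral_add (hc.intervalIntegrable _ _)
      (hc'.intervalIntegrable _ _)]
    refine intervalIntegral.integral_congr fun y _ => ?_
    have e1 := hne y
    have e2 := hne (-y)
    have e3 : (1 + y ^ 2 : ℂ) = (1 + y * Complex.I) * (1 - y * Complex.I) := by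
      linear_combination (y : ℂ) ^ 2 * Complex.I_sq
    push_cast at e2 ⊢
    rw [neg_mul, ← sub_eq_add_neg] at e2 ⊢
    rw [e3]
    field_simp
    ring
  rw [intervalIntegral.integral_ofReal, intervalIntegral.integral_const_mul,
    integral_one_div_one_add_sq, Real.arctan_neg] at h2
  have h3 : (2 : ℂ) * lineIntegral (fun s => 1 / s) T = 2 * ((2 * Real.arctan T : ℝ) : ℂ) := by
    rw [two_mul, h2]
    push_cast
    ring
  exact mul_left_cancel₀ two_ne_zero h3

/-- For L < 0 the line is moved to the right, where there are no poles; for L = 0 the integral is 2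
arctan T; for L > 0 it is moved to the left past the pole at 0. The trailing factor 1 is the
constant kernel from which the geometric factors are later built up. -/
lemma tendsto_lineIntegral_exp_div (L : ℝ) :
    Tendsto (lineIntegral fun s => Complex.exp (L * s) / s * 1) atTop
      (𝓝 ((2 * Real.pi * heavisideHalf L : ℝ) : ℂ)) := by
  have hs0 : ∀ s : ℂ, 1 ≤ s.re → s ≠ 0 := fun s hs h => by
    rw [h] at hs; simp at hs; linarith
  rcases lt_trichotomy L 0 with hL | hL | hL
  · have : heavisideHalf L = 0 := by
      rw [heavisideHalf, if_neg (by linarith), if_neg hL.ne]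
    rw [this, mul_zero, Complex.ofReal_zero]
    refine tendsto_lineIntegral_zero (B := -L) (M := 1) (by linarith) zero_le_one ?_ ?_
    · intro s hs
      exact (DifferentiableAt.div (by fun_prop) (by fun_prop) (hs0 s hs)).mul_const 1
    · intro s hs
      rw [mul_one, norm_div, Complex.norm_exp]
      simp [div_eq_inv_mul]
  · have : heavisideHalf L = 1 / 2 := by
      rw [heavisideHalf, if_neg (by linarith), if_pos hL]
    rw [this]
    have h1 : (lineIntegral fun s => Complex.exp (L * s) / s * 1) =
        fun T => ((2 * Real.arctan T : ℝ) : ℂ) := by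
      funext T
      rw [← lineIntegral_inv T]
      simp [hL]
    rw [h1]
    refine (Complex.continuous_ofReal.tendsto _).comp ?_
    have h2 := (Real.tendsto_arctan_atTop.mono_right nhdsWithin_le_nhds).const_mul 2
    convert h2 using 2
    ring
  · have : heavisideHalf L = 1 := by rw [heavisideHalf, if_pos hL]
    rw [this, mul_one]
    -- With no factors at all the kernel is e^{Ls}/s: its only pole is at 0, with residue 1, and the
    -- gap condition is empty.
    have h1 := tendsto_sum_residues_sub_lineIntegral (ι := Fin 0) (α := fun _ => 1) (L := L)
      (fun _ => one_pos) (fun i => i.elim0) (by simpa using hL) (n := 0) (c := fun _ => 0)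
      (c₀ := 1) (by
        have h2 : Tendsto (fun s : ℂ => Complex.exp (L * s)) (𝓝[≠] 0) (𝓝 1) := by
          refine Tendsto.mono_left ?_ nhdsWithin_le_nhds
          have : Continuous fun s : ℂ => Complex.exp (L * s) := by fun_prop
          simpa using this.tendsto 0
        refine h2.congr' ?_
        filter_upwards [self_mem_nhdsWithin] with s hs
        have : s ≠ 0 := hs
        simp [kern]
        field_simp) (l := atTop) le_rfl one_pos (Eventually.of_forall fun R i => i.elim0)
    have h3 : Tendsto (fun T : ℝ => T / (2 * Real.pi)) atTop atTop :=
      tendsto_id.atTop_div_const (by positivity)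
    have h4 := (tendsto_const_nhds (x := (2 * Real.pi : ℂ))).sub (h1.comp h3)
    rw [sub_zero] at h4
    have h5 : ((2 * Real.pi : ℝ) : ℂ) = 2 * Real.pi := by push_cast; rfl
    rw [h5]
    refine h4.congr fun T => ?_
    have h6 : 2 * Real.pi * (T / (2 * Real.pi)) = T := by
      field_simp
    simp only [Function.comp_apply, Finset.univ_eq_empty, Finset.sum_empty, add_zero, mul_one,
      sub_sub_cancel, h6]
    exact lineIntegral_congr (fun s _ => by simp [kern]) T

lemma norm_inv_one_sub_exp_le_of_le_re {a : ℝ} {s : ℂ} (ha : 0 < a) (hs : 1 ≤ s.re) :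
    ‖(1 - Complex.exp (-(a * s)))⁻¹‖ ≤ (1 - Real.exp (-a))⁻¹ := by
  have h0 : Real.exp (-a) < 1 := by rw [Real.exp_lt_one_iff]; linarith
  have h1 : ‖Complex.exp (-(a * s))‖ ≤ Real.exp (-a) := by
    rw [Complex.norm_exp, Real.exp_le_exp]
    simp
    nlinarith
  have h3 := norm_sub_norm_le 1 (Complex.exp (-(a * s)))
  rw [norm_one] at h3
  rw [norm_inv]
  exact inv_anti₀ (by linarith) (by linarith)

lemma exp_ne_one_of_le_re {a : ℝ} {s : ℂ} (ha : 0 < a) (hs : 1 ≤ s.re) :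
    Complex.exp (-(a * s)) ≠ 1 := fun h => by
  obtain ⟨k, rfl⟩ := (exp_eq_one_iff_kernPole ha.ne').1 h
  rw [kernPole_re] at hs
  linarith

/-- `K` is holomorphic and bounded on the half plane `1 ≤ Re s`. -/
def BoundedHolomorphic (K : ℂ → ℂ) : Prop :=
  (∀ s : ℂ, 1 ≤ s.re → DifferentiableAt ℂ K s) ∧ ∃ C, 0 ≤ C ∧ ∀ s : ℂ, 1 ≤ s.re → ‖K s‖ ≤ C

lemma BoundedHolomorphic.mul_inv {K : ℂ → ℂ} (hK : BoundedHolomorphic K) {a : ℝ} (ha : 0 < a) :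
    BoundedHolomorphic fun s => K s * (1 - Complex.exp (-(a * s)))⁻¹ := by
  obtain ⟨hd, C, hC0, hC⟩ := hK
  have h0 : Real.exp (-a) < 1 := by rw [Real.exp_lt_one_iff]; linarith
  refine ⟨fun s hs => (hd s hs).mul (DifferentiableAt.fun_inv (by fun_prop)
    (sub_ne_zero.2 (exp_ne_one_of_le_re ha hs).symm)), C * (1 - Real.exp (-a))⁻¹,
    mul_nonneg hC0 (inv_nonneg.2 (by linarith)), fun s hs => ?_⟩
  rw [norm_mul]
  exact mul_le_mul (hC s hs) (norm_inv_one_sub_exp_le_of_le_re ha hs) (norm_nonneg _) hC0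

/-- Multiplying the kernel by `(1 - e^{-as})⁻¹` replaces the limit `N L` of the line integrals by
`∑ N (L - p a)`. -/
lemma tendsto_lineIntegral_mul_inv {K : ℂ → ℂ} (hK : BoundedHolomorphic K) {N : ℝ → ℝ} {L₀ : ℝ}
    (hN : ∀ L ≤ L₀, Tendsto (lineIntegral fun s => Complex.exp (L * s) / s * K s) atTop
      (𝓝 ((2 * Real.pi * N L : ℝ) : ℂ))) {a : ℝ} (ha : 0 < a) {P : ℕ} (hP : L₀ < P * a) :
    ∀ L ≤ L₀, Tendsto
      (lineIntegral fun s => Complex.exp (L * s) / s * (K s * (1 - Complex.exp (-(a * s)))⁻¹)) atTop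
      (𝓝 ((2 * Real.pi * ∑ p ∈ Finset.range P, N (L - p * a) : ℝ) : ℂ)) := by
  intro L hL
  have hs0 : ∀ s : ℂ, 1 ≤ s.re → s ≠ 0 := fun s hs h => by
    rw [h] at hs; simp at hs; linarith
  have hexp : ∀ (L : ℝ) (s : ℂ), 1 ≤ s.re →
      DifferentiableAt ℂ (fun s : ℂ => Complex.exp (L * s) / s) s := fun L s hs =>
    DifferentiableAt.div (by fun_prop) (by fun_prop) (hs0 s hs)
  have hK' := hK.mul_inv ha
  obtain ⟨C, hC0, hC⟩ := hK'.2
  -- This is the tail in 1/(1 - z) = ∑_{p<P} z^p + z^P/(1 - z) with z = e^{-as}. Its exponent L - Pa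
  -- is negative, so moving the line to the right shows that it tends to 0; no infinite sum has to
  -- be exchanged with the limit.
  have hrest : Tendsto (lineIntegral fun s => Complex.exp ((L - P * a : ℝ) * s) / s *
      (K s * (1 - Complex.exp (-(a * s)))⁻¹)) atTop (𝓝 0) := by
    refine tendsto_lineIntegral_zero (B := P * a - L) (M := C) (by linarith) hC0
      (fun s hs => (hexp _ s hs).mul (hK'.1 s hs)) fun s hs => ?_
    rw [norm_mul, norm_div, Complex.norm_exp, Complex.re_ofReal_mul]
    have := hC s hs
    have e : -(P * a - L) * s.re = (L - P * a) * s.re := by ring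
    rw [e]
    calc _ ≤ Real.exp ((L - P * a) * s.re) / ‖s‖ * C := by gcongr
      _ = _ := by ring
  have hmain : Tendsto (fun T => ∑ p ∈ Finset.range P,
      lineIntegral (fun s => Complex.exp ((L - p * a : ℝ) * s) / s * K s) T) atTop
      (𝓝 (∑ p ∈ Finset.range P, ((2 * Real.pi * N (L - p * a) : ℝ) : ℂ))) := by
    refine tendsto_finsetSum _ fun p _ => hN _ ?_
    have : 0 ≤ (p : ℝ) * a := by positivity
    linarith
  have h := hmain.add hrest
  rw [add_zero] at h
  rw [Finset.mul_sum, Complex.ofReal_sum]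
  refine h.congr fun T => ?_
  have hterm : ∀ p ∈ Finset.range P, ∀ s : ℂ, 1 ≤ s.re → DifferentiableAt ℂ
      (fun s : ℂ => Complex.exp ((L - p * a : ℝ) * s) / s * K s) s :=
    fun p _ s hs => (hexp _ s hs).mul (hK.1 s hs)
  have hlast : ∀ s : ℂ, 1 ≤ s.re → DifferentiableAt ℂ (fun s : ℂ =>
      Complex.exp ((L - P * a : ℝ) * s) / s * (K s * (1 - Complex.exp (-(a * s)))⁻¹)) s :=
    fun s hs => (hexp _ s hs).mul (hK'.1 s hs)
  rw [← lineIntegral_sum _ hterm,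
    ← lineIntegral_add (fun s hs => DifferentiableAt.fun_sum fun p hp => hterm p hp s hs) hlast]
  refine lineIntegral_congr (fun s hs => ?_) T
  have hz1 := exp_ne_one_of_le_re ha hs.ge
  set z := Complex.exp (-(a * s)) with hz
  have hpow : ∀ p : ℕ, Complex.exp ((L - p * a : ℝ) * s) = Complex.exp (L * s) * z ^ p := by
    intro p
    rw [hz, ← Complex.exp_nat_mul, ← Complex.exp_add]
    congr 1
    push_cast
    ring
  simp only [hpow]
  have hg := mul_neg_geom_sum z P
  have h1z : 1 - z ≠ 0 := sub_ne_zero.2 hz1.symm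
  have hs' := hs0 s hs.ge
  have e : ∑ p ∈ Finset.range P, Complex.exp (L * s) * z ^ p / s * K s =
      Complex.exp (L * s) / s * K s * ∑ p ∈ Finset.range P, z ^ p := by
    rw [Finset.mul_sum]
    exact Finset.sum_congr rfl fun p _ => by ring
  have e2 : ∑ p ∈ Finset.range P, z ^ p = (1 - z ^ P) * (1 - z)⁻¹ := by
    rw [← hg]; field_simp
  rw [e, e2]
  ring

lemma boundedHolomorphic_one : BoundedHolomorphic fun _ => 1 :=
  ⟨fun _ _ => differentiableAt_const _, 1, zero_le_one, fun _ _ => by simp⟩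

lemma tendsto_lineIntegral_kern_one {a L : ℝ} (ha : 0 < a) {P : ℕ} (hP : L < P * a) :
    Tendsto (lineIntegral (kern ![a] L)) atTop
      (𝓝 ((2 * Real.pi * ∑ p ∈ Finset.range P, heavisideHalf (L - p * a) : ℝ) : ℂ)) := by
  have h := tendsto_lineIntegral_mul_inv boundedHolomorphic_one
    (fun L _ => tendsto_lineIntegral_exp_div L) ha hP L le_rfl
  refine h.congr fun T => lineIntegral_congr (fun s _ => ?_) T
  simp [kern]

lemma tendsto_lineIntegral_kern_two {a b L : ℝ} (ha : 0 < a) (hb : 0 < b) {P : ℕ}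
    (hPa : L < P * a) (hPb : L < P * b) :
    Tendsto (lineIntegral (kern ![a, b] L)) atTop
      (𝓝 ((2 * Real.pi * ∑ q ∈ Finset.range P, ∑ p ∈ Finset.range P,
        heavisideHalf (L - q * b - p * a) : ℝ) : ℂ)) := by
  have h := tendsto_lineIntegral_mul_inv (boundedHolomorphic_one.mul_inv ha)
    (tendsto_lineIntegral_mul_inv boundedHolomorphic_one
    (fun L _ => tendsto_lineIntegral_exp_div L) ha hPa) hb hPb L le_rfl
  refine h.congr fun T => lineIntegral_congr (fun s _ => ?_) T
  simp only [kern, Fin.prod_univ_two, Matrix.cons_val_zero, Matrix.cons_val_one]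
  ring

lemma tendsto_lineIntegral_kern_three {a b c L : ℝ} (ha : 0 < a) (hb : 0 < b) (hc : 0 < c) {P : ℕ}
    (hPa : L < P * a) (hPb : L < P * b) (hPc : L < P * c) :
    Tendsto (lineIntegral (kern ![a, b, c] L)) atTop
      (𝓝 ((2 * Real.pi * ∑ r ∈ Finset.range P, ∑ q ∈ Finset.range P, ∑ p ∈ Finset.range P,
        heavisideHalf (L - r * c - q * b - p * a) : ℝ) : ℂ)) := by
  have h := tendsto_lineIntegral_mul_inv ((boundedHolomorphic_one.mul_inv ha).mul_inv hb)
    (tendsto_lineIntegral_mul_inv (boundedHolomorphic_one.mul_inv ha)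
    (tendsto_lineIntegral_mul_inv boundedHolomorphic_one
    (fun L _ => tendsto_lineIntegral_exp_div L) ha hPa) hb hPb) hc hPc L le_rfl
  refine h.congr fun T => lineIntegral_congr (fun s _ => ?_) T
  simp only [kern, Fin.prod_univ_three, Matrix.cons_val_zero, Matrix.cons_val_one, Matrix.cons_val]
  ring

/-! ### Laurent expansion of the kernel at 0 -/

/-- `f s = c₀ + c₁ s + c₂ s² + c₃ s³ + o(s³)` as `s → 0`. -/
def HasExpansion (f : ℂ → ℂ) (c₀ c₁ c₂ c₃ : ℂ) : Prop :=
  ∃ r : ℂ → ℂ, Tendsto r (𝓝[≠] 0) (𝓝 c₃) ∧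
    ∀ᶠ s in 𝓝[≠] (0 : ℂ), f s = c₀ + c₁ * s + c₂ * s ^ 2 + r s * s ^ 3

lemma tendsto_id_nhdsNE_zero : Tendsto (fun s : ℂ => s) (𝓝[≠] 0) (𝓝 0) :=
  tendsto_id.mono_left nhdsWithin_le_nhds

lemma HasExpansion.mul {f g : ℂ → ℂ} {c₀ c₁ c₂ c₃ d₀ d₁ d₂ d₃ : ℂ}
    (hf : HasExpansion f c₀ c₁ c₂ c₃) (hg : HasExpansion g d₀ d₁ d₂ d₃) :
    HasExpansion (fun s => f s * g s) (c₀ * d₀) (c₀ * d₁ + c₁ * d₀) (c₀ * d₂ + c₁ * d₁ + c₂ * d₀)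
      (c₀ * d₃ + c₁ * d₂ + c₂ * d₁ + c₃ * d₀) := by
  obtain ⟨r, hr, hfr⟩ := hf
  obtain ⟨q, hq, hgq⟩ := hg
  refine ⟨fun s => c₀ * q s + c₁ * d₂ + c₂ * d₁ + r s * d₀ +
    s * (c₁ * q s + c₂ * d₂ + r s * d₁ + s * (c₂ * q s + r s * d₂ + s * (r s * q s))), ?_, ?_⟩
  · have hs := tendsto_id_nhdsNE_zero
    have h1 := (hq.const_mul c₂).add (hr.mul_const d₂) |>.add (hs.mul (hr.mul hq))
    have h2 := ((hq.const_mul c₁).add_const (c₂ * d₂)).add (hr.mul_const d₁) |>.add (hs.mul h1)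
    have h3 := (((hq.const_mul c₀).add_const (c₁ * d₂)).add_const (c₂ * d₁)).add (hr.mul_const d₀)
      |>.add (hs.mul h2)
    rw [zero_mul, add_zero] at h3
    exact h3
  · filter_upwards [hfr, hgq] with s h1 h2
    rw [h1, h2]
    ring

/-- After subtracting one further Taylor term the remainder is at most ‖z‖^{n+1} e^{‖z‖}. -/
lemma tendsto_exp_remainder (n : ℕ) :
    Tendsto (fun z : ℂ => (Complex.exp z - ∑ m ∈ Finset.range n, z ^ m / m.factorial) / z ^ n)
      (𝓝[≠] 0) (𝓝 (1 / n.factorial)) := by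
  have h1 : Tendsto (fun z : ℂ => ‖z‖ * Real.exp ‖z‖) (𝓝[≠] 0) (𝓝 0) := by
    refine Tendsto.mono_left ?_ nhdsWithin_le_nhds
    have : Continuous fun z : ℂ => ‖z‖ * Real.exp ‖z‖ := by fun_prop
    simpa using this.tendsto 0
  rw [← tendsto_sub_nhds_zero_iff]
  refine squeeze_zero_norm' ?_ h1
  filter_upwards [self_mem_nhdsWithin] with z hz
  have hz0 : z ≠ 0 := hz
  have h2 := Complex.norm_exp_sub_sum_le_norm_mul_exp z (n + 1)
  rw [Finset.sum_range_succ] at h2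
  have e : (Complex.exp z - ∑ m ∈ Finset.range n, z ^ m / m.factorial) / z ^ n - 1 / n.factorial =
      (Complex.exp z - (∑ m ∈ Finset.range n, z ^ m / m.factorial + z ^ n / n.factorial)) /
        z ^ n := by
    field_simp
    ring
  rw [e, norm_div, norm_pow, div_le_iff₀ (by positivity)]
  refine h2.trans (le_of_eq ?_)
  ring

lemma hasExpansion_exp (L : ℂ) :
    HasExpansion (fun s => Complex.exp (L * s)) 1 L (L ^ 2 / 2) (L ^ 3 / 6) := by
  by_cases hL : L = 0
  · exact ⟨fun _ => 0, by simp [hL], by simp [hL]⟩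
  have hz : Tendsto (fun s : ℂ => L * s) (𝓝[≠] 0) (𝓝[≠] 0) := by
    refine tendsto_nhdsWithin_iff.2 ⟨?_, ?_⟩
    · simpa using tendsto_id_nhdsNE_zero.const_mul L
    · filter_upwards [self_mem_nhdsWithin] with s hs
      exact mul_ne_zero hL hs
  have h := ((tendsto_exp_remainder 3).comp hz).const_mul (L ^ 3)
  have e : L ^ 3 / 6 = L ^ 3 * (1 / ((3).factorial : ℂ)) := by
    norm_num [Nat.factorial]
    ring
  rw [e]
  refine ⟨_, h, ?_⟩
  filter_upwards [self_mem_nhdsWithin] with s hs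
  have : s ≠ 0 := hs
  simp only [Function.comp_apply, Finset.sum_range_succ, Finset.sum_range_zero]
  simp [Nat.factorial]
  field_simp
  ring

/-- These are the first Bernoulli numbers; the coefficient 0 of s³ reflects the vanishing of the
fourth coefficient of t/(1 - e^{-t}). -/
lemma hasExpansion_div_one_sub_exp {a : ℂ} (ha : a ≠ 0) :
    HasExpansion (fun s => s * (1 - Complex.exp (-(a * s)))⁻¹) (1 / a) (1 / 2) (a / 12) 0 := by
  have hz : Tendsto (fun s : ℂ => -(a * s)) (𝓝[≠] 0) (𝓝[≠] 0) := by
    refine tendsto_nhdsWithin_iff.2 ⟨?_, ?_⟩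
    · simpa using (tendsto_id_nhdsNE_zero.const_mul a).neg
    · filter_upwards [self_mem_nhdsWithin] with s hs
      exact neg_ne_zero.2 (mul_ne_zero ha hs)
  -- The exponential is needed to order 4, because one order is lost on dividing by the simple zero
  -- of 1 - e^{-as}.
  have h := (tendsto_exp_remainder 4).comp hz
  set e : ℂ → ℂ := (fun z : ℂ => (Complex.exp z - ∑ m ∈ Finset.range 4, z ^ m / m.factorial) /
    z ^ 4) ∘ fun s : ℂ => -(a * s) with he
  have hexp : ∀ s : ℂ, s ≠ 0 → Complex.exp (-(a * s)) =
      1 - a * s + (a * s) ^ 2 / 2 - (a * s) ^ 3 / 6 + (a * s) ^ 4 * e s := by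
    intro s hs
    simp only [he, Function.comp_apply, Finset.sum_range_succ, Finset.sum_range_zero]
    simp [Nat.factorial]
    field_simp
    ring
  have h4 : (1 / ((4).factorial : ℂ)) = 1 / 24 := by norm_num [Nat.factorial]
  rw [h4] at h
  set D : ℂ → ℂ := fun s => 1 + s * (-(a / 2) + s * (a ^ 2 / 6 - s * (a ^ 3 * e s))) with hD
  have hs := tendsto_id_nhdsNE_zero
  have hDlim : Tendsto D (𝓝[≠] 0) (𝓝 1) := by
    have h1 := (hs.mul ((hs.mul ((hs.mul (h.const_mul (a ^ 3))).const_sub (a ^ 2 / 6))).const_add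
      (-(a / 2)))).const_add 1
    rw [zero_mul, add_zero] at h1
    exact h1
  have hD0 : ∀ᶠ s in 𝓝[≠] (0 : ℂ), D s ≠ 0 := hDlim.eventually_ne one_ne_zero
  -- With 1 - e^{-as} = as·D(s), this remainder is obtained by solving 1/(aD) = 1/a + s/2 + as²/12 +
  -- r s³ for r. It tends to 0 because e(s) → 1/24.
  refine ⟨fun s => a ^ 2 * (e s - 1 / 24 + s * (a * (e s / 2 - 1 / 72) + s * (a ^ 2 * (e s / 12)))) /
    D s, ?_, ?_⟩
  · have h1 := (((h.sub_const (1 / 24)).add (hs.mul ((((h.div_const 2).sub_const (1 / 72)).const_mul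
      a).add (hs.mul ((h.div_const 12).const_mul (a ^ 2)))))).const_mul (a ^ 2)).div hDlim one_ne_zero
    rw [sub_self, zero_mul, add_zero, mul_zero, zero_div] at h1
    exact h1
  · filter_upwards [hD0, self_mem_nhdsWithin] with s h1 h2
    have hs0 : s ≠ 0 := h2
    have e1 : 1 - Complex.exp (-(a * s)) = a * s * D s := by
      rw [hexp s hs0, hD]
      ring
    rw [e1]
    field_simp
    rw [hD]
    ring

lemma tendsto_kern_one {a : ℝ} (ha : 0 < a) (L : ℝ) :
    ∃ c : ℕ → ℂ, Tendsto (fun s => s * (kern ![a] L s -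
      ∑ m ∈ Finset.range 1, c m * (s ^ (m + 2))⁻¹)) (𝓝[≠] 0) (𝓝 ((L / a + 1 / 2 : ℝ) : ℂ)) := by
  have ha' : (a : ℂ) ≠ 0 := by exact_mod_cast ha.ne'
  obtain ⟨r, hr, h⟩ := (hasExpansion_exp L).mul (hasExpansion_div_one_sub_exp ha')
  refine ⟨fun _ => 1 / a, ?_⟩
  have hs := tendsto_id_nhdsNE_zero
  have h1 := (hs.mul ((hs.mul hr).const_add
    (1 * ((a : ℂ) / 12) + L * (1 / 2) + L ^ 2 / 2 * (1 / a)))).const_add (1 * (1 / 2 : ℂ) + L * (1 / a))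
  have e : ((L / a + 1 / 2 : ℝ) : ℂ) = 1 * (1 / 2 : ℂ) + L * (1 / a) := by push_cast; ring
  rw [zero_mul, add_zero, ← e] at h1
  refine h1.congr' ?_
  filter_upwards [h, self_mem_nhdsWithin] with s h2 h3
  have hs0 : s ≠ 0 := h3
  have e2 : kern ![a] L s = Complex.exp (L * s) * (s * (1 - Complex.exp (-(a * s)))⁻¹) / s ^ 2 := by
    simp only [kern, Fin.prod_univ_one, Matrix.cons_val_zero]
    field_simp
  rw [e2, h2, Finset.sum_range_one, e]
  field_simp
  ring

/-- Only the existence and the reality of the residue at 0 are recorded: it enters the limits for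
pairs of bases, which cancel in the final formula. -/
lemma tendsto_kern_two {a b : ℝ} (ha : 0 < a) (hb : 0 < b) (L : ℝ) :
    ∃ (c : ℕ → ℂ) (c₀ : ℝ), Tendsto (fun s => s * (kern ![a, b] L s -
      ∑ m ∈ Finset.range 2, c m * (s ^ (m + 2))⁻¹)) (𝓝[≠] 0) (𝓝 (c₀ : ℂ)) := by
  have ha' : (a : ℂ) ≠ 0 := by exact_mod_cast ha.ne'
  have hb' : (b : ℂ) ≠ 0 := by exact_mod_cast hb.ne'
  obtain ⟨r, hr, h⟩ := ((hasExpansion_exp L).mul (hasExpansion_div_one_sub_exp ha')).mul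
    (hasExpansion_div_one_sub_exp hb')
  set e₀ : ℂ := 1 * (1 / (a : ℂ)) * (1 / b) with he₀
  set e₁ : ℂ := 1 * (1 / (a : ℂ)) * (1 / 2) + (1 * (1 / 2) + L * (1 / a)) * (1 / b) with he₁
  refine ⟨fun m => if m = 0 then e₁ else e₀, a / (12 * b) + b / (12 * a) + 1 / 4 + L / (2 * a) +
    L / (2 * b) + L ^ 2 / (2 * a * b), ?_⟩
  have hs := tendsto_id_nhdsNE_zero
  have h1 := (hs.mul hr).const_add (1 * (1 / (a : ℂ)) * (b / 12) +
    (1 * (1 / 2) + L * (1 / a)) * (1 / 2) +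
    (1 * ((a : ℂ) / 12) + L * (1 / 2) + L ^ 2 / 2 * (1 / a)) * (1 / b))
  rw [zero_mul, add_zero] at h1
  have e : ((a / (12 * b) + b / (12 * a) + 1 / 4 + L / (2 * a) + L / (2 * b) +
      L ^ 2 / (2 * a * b) : ℝ) : ℂ) = 1 * (1 / (a : ℂ)) * (b / 12) +
    (1 * (1 / 2) + L * (1 / a)) * (1 / 2) +
    (1 * ((a : ℂ) / 12) + L * (1 / 2) + L ^ 2 / 2 * (1 / a)) * (1 / b) := by
    push_cast
    field_simp
    ring
  rw [e]
  refine h1.congr' ?_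
  filter_upwards [h, self_mem_nhdsWithin] with s h2 h3
  have hs0 : s ≠ 0 := h3
  have e2 : kern ![a, b] L s = Complex.exp (L * s) * (s * (1 - Complex.exp (-(a * s)))⁻¹) *
      (s * (1 - Complex.exp (-(b * s)))⁻¹) / s ^ 3 := by
    simp only [kern, Fin.prod_univ_two, Matrix.cons_val_zero, Matrix.cons_val_one]
    field_simp
  rw [e2, h2, Finset.sum_range_succ, Finset.sum_range_one, if_pos rfl, if_neg one_ne_zero]
  generalize (1 * (1 / (a : ℂ)) * (b / 12) + (1 * (1 / 2) + L * (1 / a)) * (1 / 2) +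
    (1 * ((a : ℂ) / 12) + L * (1 / 2) + L ^ 2 / 2 * (1 / a)) * (1 / b)) = e₂
  clear_value e₀ e₁
  field_simp
  ring

/-- The residue at `0` of `kern ![a, b, c] L`. -/
def residueThree (a b c L : ℝ) : ℝ :=
  L ^ 3 / (6 * a * b * c) + L ^ 2 / (4 * a * b) + L ^ 2 / (4 * a * c) + L ^ 2 / (4 * b * c) +
    L / (4 * a) + L / (4 * b) + L / (4 * c) + a * L / (12 * b * c) + b * L / (12 * a * c) +
    c * L / (12 * a * b) + a / (24 * b) + a / (24 * c) + b / (24 * a) + b / (24 * c) +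
    c / (24 * a) + c / (24 * b) + 1 / 8

/-- Three factors and 1/s make a pole of order 4, so the residue is the s³-coefficient of the
product of the four expansions; the lower coefficients give the polar terms `d m`. -/
lemma tendsto_kern_three {a b c : ℝ} (ha : 0 < a) (hb : 0 < b) (hc : 0 < c) (L : ℝ) :
    ∃ d : ℕ → ℂ, Tendsto (fun s => s * (kern ![a, b, c] L s -
      ∑ m ∈ Finset.range 3, d m * (s ^ (m + 2))⁻¹)) (𝓝[≠] 0)
      (𝓝 ((residueThree a b c L : ℝ) : ℂ)) := by
  have ha' : (a : ℂ) ≠ 0 := by exact_mod_cast ha.ne'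
  have hb' : (b : ℂ) ≠ 0 := by exact_mod_cast hb.ne'
  have hc' : (c : ℂ) ≠ 0 := by exact_mod_cast hc.ne'
  have hexp := (((hasExpansion_exp L).mul (hasExpansion_div_one_sub_exp ha')).mul
    (hasExpansion_div_one_sub_exp hb')).mul (hasExpansion_div_one_sub_exp hc')
  obtain ⟨e₀, e₁, e₂, e₃, he₃, r, hr, h⟩ : ∃ e₀ e₁ e₂ e₃ : ℂ,
      e₃ = ((residueThree a b c L : ℝ) : ℂ) ∧ HasExpansion (fun s => Complex.exp (L * s) *
      (s * (1 - Complex.exp (-(a * s)))⁻¹) * (s * (1 - Complex.exp (-(b * s)))⁻¹) *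
      (s * (1 - Complex.exp (-(c * s)))⁻¹)) e₀ e₁ e₂ e₃ := by
    refine ⟨_, _, _, _, ?_, hexp⟩
    rw [residueThree]
    push_cast
    field_simp
    ring
  refine ⟨fun m => if m = 0 then e₂ else if m = 1 then e₁ else e₀, ?_⟩
  rw [← he₃]
  refine hr.congr' ?_
  filter_upwards [h, self_mem_nhdsWithin] with s h2 h3
  have hs0 : s ≠ 0 := h3
  have e2 : kern ![a, b, c] L s = Complex.exp (L * s) * (s * (1 - Complex.exp (-(a * s)))⁻¹) *
      (s * (1 - Complex.exp (-(b * s)))⁻¹) * (s * (1 - Complex.exp (-(c * s)))⁻¹) / s ^ 4 := by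
    simp only [kern, Fin.prod_univ_three, Matrix.cons_val_zero, Matrix.cons_val_one,
      Matrix.cons_val]
    field_simp
  rw [e2, h2, Finset.sum_range_succ, Finset.sum_range_succ, Finset.sum_range_one, if_pos rfl,
    if_neg one_ne_zero, if_pos rfl, if_neg two_ne_zero, if_neg (by norm_num)]
  field_simp
  ring

/-! ### The residues in real trigonometric form -/

lemma sum_nonzeroInts (x : ℝ) (g : ℤ → ℂ) :
    ∑ k ∈ nonzeroInts x, g k = ∑ k ∈ Finset.Icc 1 ⌊x⌋₊, (g (k : ℤ) + g (-(k : ℤ))) := by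
  rw [nonzeroInts]
  generalize ⌊x⌋₊ = n
  induction n with
  | zero => simp
  | succ n ih =>
    have e : (Finset.Icc (-((n + 1 : ℕ) : ℤ)) ((n + 1 : ℕ) : ℤ)).erase 0 =
        insert ((n + 1 : ℕ) : ℤ) (insert (-((n + 1 : ℕ) : ℤ))
          ((Finset.Icc (-(n : ℤ)) (n : ℤ)).erase 0)) := by
      ext k
      simp only [Finset.mem_erase, Finset.mem_Icc, Finset.mem_insert]
      push_cast
      omega
    rw [e, Finset.sum_insert, Finset.sum_insert, ih, Finset.sum_Icc_succ_top (by omega)]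
    · ring
    · simp only [Finset.mem_erase, Finset.mem_Icc]
      push_cast
      omega
    · simp only [Finset.mem_erase, Finset.mem_Icc, Finset.mem_insert]
      push_cast
      omega

/-- The left side equals e^{iθ}/(2i sin θ). -/
lemma inv_one_sub_exp_neg_two_mul_I {θ : ℝ} (hθ : Real.sin θ ≠ 0) :
    (1 - Complex.exp (-(2 * θ * Complex.I)))⁻¹ =
      (1 - ((Real.cos θ / Real.sin θ : ℝ) : ℂ) * Complex.I) / 2 := by
  have h1 : Complex.exp (-(2 * θ * Complex.I)) =
      (Real.cos θ - Real.sin θ * Complex.I) ^ 2 := by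
    have : -(2 * θ * Complex.I) = ((2 : ℕ) : ℂ) * ((-θ : ℝ) * Complex.I) := by push_cast; ring
    rw [this, Complex.exp_nat_mul, Complex.exp_mul_I, ← Complex.ofReal_cos, ← Complex.ofReal_sin,
      Real.cos_neg, Real.sin_neg]
    push_cast
    ring
  have hs : (Real.sin θ : ℂ) ≠ 0 := by exact_mod_cast hθ
  have hp : (Real.sin θ : ℂ) ^ 2 + (Real.cos θ : ℂ) ^ 2 = 1 := by
    exact_mod_cast Real.sin_sq_add_cos_sq θ
  rw [h1]
  refine inv_eq_of_mul_eq_one_right ?_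
  push_cast [-Complex.ofReal_cos, -Complex.ofReal_sin]
  generalize (Real.sin θ : ℂ) = S at *
  generalize (Real.cos θ : ℂ) = C at *
  field_simp
  have hI := Complex.I_sq
  generalize Complex.I = I at *
  linear_combination (C * S ^ 2 * I - 2 * C ^ 2 * S - S ^ 3) * hI + (C * I + S) * hp

lemma sin_ne_zero_of_indep {a b : ℝ} (ha : 0 < a)
    (hab : ∀ k k' : ℤ, k * b = k' * a → k = 0) {k : ℤ} (hk : k ≠ 0) :
    Real.sin (Real.pi * k * b / a) ≠ 0 := by
  intro h
  obtain ⟨n, hn⟩ := Real.sin_eq_zero_iff.1 h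
  refine hk (hab k n ?_)
  have := Real.pi_pos
  field_simp at hn
  linarith

/-- The cotangent of `πkb/a`. -/
def cotRatio (a b : ℝ) (k : ℤ) : ℝ :=
  Real.cos (Real.pi * k * b / a) / Real.sin (Real.pi * k * b / a)

lemma cotRatio_neg (a b : ℝ) (k : ℤ) : cotRatio a b (-k) = -cotRatio a b k := by
  have : Real.pi * ((-k : ℤ) : ℝ) * b / a = -(Real.pi * k * b / a) := by push_cast; ring
  rw [cotRatio, cotRatio, this, Real.cos_neg, Real.sin_neg, div_neg]

lemma kernRes_eq {ι : Type*} [Fintype ι] [DecidableEq ι] {α : ι → ℝ} (hα : ∀ i, 0 < α i)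
    (hirr : ∀ i j, i ≠ j → ∀ k k' : ℤ, k * α j = k' * α i → k = 0) (L : ℝ) (i : ι) {k : ℤ}
    (hk : k ≠ 0) :
    kernRes α L i k =
      ((Real.sin (2 * Real.pi * k * (L / α i)) : ℝ) -
        (Real.cos (2 * Real.pi * k * (L / α i)) : ℝ) * Complex.I) / (2 * Real.pi * k) *
      ∏ j ∈ Finset.univ.erase i, ((1 - (cotRatio (α i) (α j) k : ℂ) * Complex.I) / 2) := by
  have hk' : (k : ℂ) ≠ 0 := by exact_mod_cast hk
  have hpi : (Real.pi : ℂ) ≠ 0 := by exact_mod_cast Real.pi_ne_zero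
  have hai : (α i : ℂ) ≠ 0 := by exact_mod_cast (hα i).ne'
  rw [kernRes]
  congr 1
  · have e : (L : ℂ) * kernPole (α i) k = (2 * Real.pi * k * (L / α i) : ℝ) * Complex.I := by
      rw [kernPole]; push_cast; ring
    rw [e, Complex.exp_mul_I, ← Complex.ofReal_cos, ← Complex.ofReal_sin,
      div_eq_div_iff (by simp [hk', hpi]) (by simp [hk', hpi])]
    linear_combination (2 * Real.pi * k *
      (Real.cos (2 * Real.pi * k * (L / α i)) : ℂ)) * Complex.I_sq
  · refine Finset.prod_congr rfl fun j hj => ?_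
    have hs := sin_ne_zero_of_indep (hα i) (hirr i j (Finset.mem_erase.1 hj).1.symm) hk
    rw [cotRatio, ← inv_one_sub_exp_neg_two_mul_I hs, kernPole]
    congr 4
    push_cast
    field_simp

/-- The terms of the residue series for one base. -/
def termOne (L a : ℝ) (k : ℕ) : ℝ := Real.sin (2 * Real.pi * k * (L / a)) / (Real.pi * k)

/-- The terms of the residue series with base `a` for the two bases `a`, `b`. -/
def termTwo (L a b : ℝ) (k : ℕ) : ℝ :=
  (Real.sin (2 * Real.pi * k * (L / a)) -
    Real.cos (2 * Real.pi * k * (L / a)) * cotRatio a b k) / (2 * Real.pi * k)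

/-- The terms of the residue series with base `a` for the three bases `a`, `b`, `c`. -/
def termThree (L a b c : ℝ) (k : ℕ) : ℝ :=
  (Real.sin (2 * Real.pi * k * (L / a)) * (1 - cotRatio a b k * cotRatio a c k) -
    Real.cos (2 * Real.pi * k * (L / a)) * (cotRatio a b k + cotRatio a c k)) / (4 * Real.pi * k)

lemma sin_mul_neg_intCast (k : ℕ) (y : ℝ) :
    Real.sin (2 * Real.pi * ((-(k : ℤ) : ℤ) : ℝ) * y) = -Real.sin (2 * Real.pi * k * y) := by
  rw [← Real.sin_neg]; congr 1; push_cast; ring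

lemma cos_mul_neg_intCast (k : ℕ) (y : ℝ) :
    Real.cos (2 * Real.pi * ((-(k : ℤ) : ℤ) : ℝ) * y) = Real.cos (2 * Real.pi * k * y) := by
  rw [← Real.cos_neg]; congr 1; push_cast; ring

lemma natCast_pos_of_mem {n k : ℕ} (hk : k ∈ Finset.Icc 1 n) : k ≠ 0 := by
  have := (Finset.mem_Icc.1 hk).1
  omega

/-- The residues at k and -k are complex conjugates, so each pair adds up to twice a real part. The
same holds in the next two lemmas, where expanding one or two factors (1 - i cot)/2 gives `termTwo`
and `termThree`. -/
lemma sum_kernRes_of_card_zero {ι : Type*} [Fintype ι] [DecidableEq ι] {α : ι → ℝ}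
    (hα : ∀ i, 0 < α i) (hirr : ∀ i j, i ≠ j → ∀ k k' : ℤ, k * α j = k' * α i → k = 0) (L x : ℝ)
    (i : ι) (hi : Finset.univ.erase i = ∅) :
    ∑ k ∈ nonzeroInts x, kernRes α L i k =
      ((∑ k ∈ Finset.Icc 1 ⌊x⌋₊, termOne L (α i) k : ℝ) : ℂ) := by
  rw [sum_nonzeroInts, Complex.ofReal_sum]
  refine Finset.sum_congr rfl fun k hk => ?_
  have hk0 := natCast_pos_of_mem hk
  have hk1 : (k : ℤ) ≠ 0 := by exact_mod_cast hk0
  have hk2 : (k : ℂ) ≠ 0 := by exact_mod_cast hk0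
  have hpi : (Real.pi : ℂ) ≠ 0 := by exact_mod_cast Real.pi_ne_zero
  rw [kernRes_eq hα hirr L i hk1, kernRes_eq hα hirr L i (neg_ne_zero.2 hk1), hi,
    sin_mul_neg_intCast, cos_mul_neg_intCast, termOne, Int.cast_natCast]
  simp only [Finset.prod_empty, mul_one]
  push_cast [-Complex.ofReal_cos, -Complex.ofReal_sin]
  field_simp
  ring

lemma sum_kernRes_of_card_one {ι : Type*} [Fintype ι] [DecidableEq ι] {α : ι → ℝ}
    (hα : ∀ i, 0 < α i) (hirr : ∀ i j, i ≠ j → ∀ k k' : ℤ, k * α j = k' * α i → k = 0) (L x : ℝ)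
    (i j : ι) (hi : Finset.univ.erase i = {j}) :
    ∑ k ∈ nonzeroInts x, kernRes α L i k =
      ((∑ k ∈ Finset.Icc 1 ⌊x⌋₊, termTwo L (α i) (α j) k : ℝ) : ℂ) := by
  rw [sum_nonzeroInts, Complex.ofReal_sum]
  refine Finset.sum_congr rfl fun k hk => ?_
  have hk0 := natCast_pos_of_mem hk
  have hk1 : (k : ℤ) ≠ 0 := by exact_mod_cast hk0
  have hk2 : (k : ℂ) ≠ 0 := by exact_mod_cast hk0
  have hpi : (Real.pi : ℂ) ≠ 0 := by exact_mod_cast Real.pi_ne_zero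
  rw [kernRes_eq hα hirr L i hk1, kernRes_eq hα hirr L i (neg_ne_zero.2 hk1), hi,
    sin_mul_neg_intCast, cos_mul_neg_intCast, termTwo, Int.cast_natCast]
  simp only [Finset.prod_singleton, cotRatio_neg]
  push_cast [-Complex.ofReal_cos, -Complex.ofReal_sin]
  generalize (Real.sin (2 * Real.pi * k * (L / α i)) : ℂ) = S
  generalize (Real.cos (2 * Real.pi * k * (L / α i)) : ℂ) = C
  generalize (cotRatio (α i) (α j) k : ℂ) = u
  have hI := Complex.I_sq
  generalize Complex.I = I at *
  field_simp
  linear_combination (2 * C * u) * hI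

lemma sum_kernRes_of_card_two {ι : Type*} [Fintype ι] [DecidableEq ι] {α : ι → ℝ}
    (hα : ∀ i, 0 < α i) (hirr : ∀ i j, i ≠ j → ∀ k k' : ℤ, k * α j = k' * α i → k = 0) (L x : ℝ)
    (i j l : ι) (hjl : j ≠ l) (hi : Finset.univ.erase i = {j, l}) :
    ∑ k ∈ nonzeroInts x, kernRes α L i k =
      ((∑ k ∈ Finset.Icc 1 ⌊x⌋₊, termThree L (α i) (α j) (α l) k : ℝ) : ℂ) := by
  rw [sum_nonzeroInts, Complex.ofReal_sum]
  refine Finset.sum_congr rfl fun k hk => ?_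
  have hk0 := natCast_pos_of_mem hk
  have hk1 : (k : ℤ) ≠ 0 := by exact_mod_cast hk0
  have hk2 : (k : ℂ) ≠ 0 := by exact_mod_cast hk0
  have hpi : (Real.pi : ℂ) ≠ 0 := by exact_mod_cast Real.pi_ne_zero
  rw [kernRes_eq hα hirr L i hk1, kernRes_eq hα hirr L i (neg_ne_zero.2 hk1), hi,
    sin_mul_neg_intCast, cos_mul_neg_intCast, termThree, Int.cast_natCast]
  simp only [Finset.prod_pair hjl, cotRatio_neg]
  push_cast [-Complex.ofReal_cos, -Complex.ofReal_sin]
  generalize (Real.sin (2 * Real.pi * k * (L / α i)) : ℂ) = S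
  generalize (Real.cos (2 * Real.pi * k * (L / α i)) : ℂ) = C
  generalize (cotRatio (α i) (α j) k : ℂ) = u
  generalize (cotRatio (α i) (α l) k : ℂ) = v
  have hI := Complex.I_sq
  generalize Complex.I = I at *
  field_simp
  linear_combination (8 * (S * u * v + C * (u + v))) * hI

/-! ### Convergence of the residue series for one, two and three bases -/

/-- If the line integrals converge to `2πN`, the partial sums of the residue series converge to
`N - c₀`, where `c₀` is the residue at `0`. -/
lemma tendsto_residue_series {ι : Type*} [Fintype ι] [DecidableEq ι] {α : ι → ℝ}
    (hα : ∀ i, 0 < α i) (hirr : ∀ i j, i ≠ j → ∀ k k' : ℤ, k * α j = k' * α i → k = 0) {L : ℝ}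
    (hL : 0 < L + ∑ i, α i) {n : ℕ} {c : ℕ → ℂ} {c₀ : ℝ}
    (h0 : Tendsto (fun s => s * (kern α L s - ∑ m ∈ Finset.range n, c m * (s ^ (m + 2))⁻¹))
      (𝓝[≠] 0) (𝓝 (c₀ : ℂ)))
    {l : Filter ℝ} (hl : l ≤ atTop) {δ : ℝ} (hδ : 0 < δ)
    (hgap : ∀ᶠ R in l, ∀ i, ∀ n : ℤ, δ ≤ |R * α i - n|) {N : ℝ}
    (hN : Tendsto (lineIntegral (kern α L)) atTop (𝓝 ((2 * Real.pi * N : ℝ) : ℂ)))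
    {f : ℝ → ℝ} (hf : ∀ R, ∑ i, ∑ k ∈ nonzeroInts (R * α i), kernRes α L i k = (f R : ℂ)) :
    Tendsto f l (𝓝 (N - c₀)) := by
  have h1 := tendsto_sum_residues_sub_lineIntegral hα hirr hL h0 hl hδ hgap
  have h2 : Tendsto (fun R : ℝ => 2 * Real.pi * R) l atTop :=
    (tendsto_id.const_mul_atTop (by positivity)).mono_left hl
  have h3 := h1.add (hN.comp h2)
  rw [zero_add] at h3
  have h4 := ((Complex.continuous_re.tendsto _).comp h3).div_const (2 * Real.pi) |>.sub_const c₀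
  have hpi := Real.pi_pos
  have e : (((2 * Real.pi * N : ℝ) : ℂ)).re / (2 * Real.pi) - c₀ = N - c₀ := by
    rw [Complex.ofReal_re]
    field_simp
  rw [e] at h4
  refine h4.congr fun R => ?_
  simp only [Function.comp_apply, hf, sub_add_cancel]
  have e2 : (2 * Real.pi * (c₀ + f R) : ℂ) = ((2 * Real.pi * (c₀ + f R) : ℝ) : ℂ) := by
    push_cast; rfl
  rw [e2, Complex.ofReal_re]
  field_simp
  ring

lemma tendsto_sum_termOne {a L : ℝ} (ha : 0 < a) (hL : 0 ≤ L) {P : ℕ} (hP : L < P * a)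
    {l : Filter ℝ} (hl : l ≤ atTop) {δ : ℝ} (hδ : 0 < δ)
    (hgap : ∀ᶠ R in l, ∀ n : ℤ, δ ≤ |R * a - n|) :
    Tendsto (fun R => ∑ k ∈ Finset.Icc 1 ⌊R * a⌋₊, termOne L a k) l
      (𝓝 (∑ p ∈ Finset.range P, heavisideHalf (L - p * a) - (L / a + 1 / 2))) := by
  obtain ⟨c, hc⟩ := tendsto_kern_one ha L
  have hα : ∀ i, 0 < ![a] i := fun i => by fin_cases i; simpa
  have hirr : ∀ i j : Fin 1, i ≠ j → ∀ k k' : ℤ, k * ![a] j = k' * ![a] i → k = 0 :=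
    fun i j hij => absurd (Subsingleton.elim i j) hij
  refine tendsto_residue_series hα hirr (by simp; linarith) hc hl hδ ?_
    (tendsto_lineIntegral_kern_one ha hP) fun R => ?_
  · filter_upwards [hgap] with R hR i
    fin_cases i
    simpa using hR
  · rw [Fin.sum_univ_one, sum_kernRes_of_card_zero hα hirr L _ 0 (by decide)]
    simp

/-- The limit `N` is chosen before the filter and δ, so it is the same for every δ. Its value is
left unspecified because it drops out at the end. -/
lemma exists_tendsto_sum_termTwo {a b L : ℝ} (ha : 0 < a) (hb : 0 < b) (hL : 0 ≤ L)
    (hab : ∀ k k' : ℤ, k * a = k' * b → k = 0 ∧ k' = 0) :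
    ∃ N, ∀ (l : Filter ℝ) (δ : ℝ), l ≤ atTop → 0 < δ →
      (∀ᶠ R in l, ∀ n : ℤ, δ ≤ |R * a - n| ∧ δ ≤ |R * b - n|) →
      Tendsto (fun R => ∑ k ∈ Finset.Icc 1 ⌊R * a⌋₊, termTwo L a b k +
        ∑ k ∈ Finset.Icc 1 ⌊R * b⌋₊, termTwo L b a k) l (𝓝 N) := by
  obtain ⟨c, c₀, hc⟩ := tendsto_kern_two ha hb L
  obtain ⟨P, hPa, hPb⟩ : ∃ P : ℕ, L < P * a ∧ L < P * b := by
    obtain ⟨P, hP⟩ := exists_nat_gt (max (L / a) (L / b))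
    exact ⟨P, (div_lt_iff₀ ha).1 ((le_max_left _ _).trans_lt hP),
      (div_lt_iff₀ hb).1 ((le_max_right _ _).trans_lt hP)⟩
  have hα : ∀ i, 0 < ![a, b] i := fun i => by fin_cases i <;> simpa
  have hirr : ∀ i j : Fin 2, i ≠ j → ∀ k k' : ℤ, k * ![a, b] j = k' * ![a, b] i → k = 0 := by
    intro i j hij k k' h
    fin_cases i <;> fin_cases j <;> simp at hij h
    · exact (hab k' k h.symm).2
    · exact (hab k k' h).1
  refine ⟨_, fun l δ hl hδ hgap => tendsto_residue_series hα hirr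
    (by simp [Fin.sum_univ_two]; linarith) hc hl hδ ?_
    (tendsto_lineIntegral_kern_two ha hb hPa hPb) fun R => ?_⟩
  · filter_upwards [hgap] with R hR i
    fin_cases i
    · simpa using fun n => (hR n).1
    · simpa using fun n => (hR n).2
  · rw [Fin.sum_univ_two, sum_kernRes_of_card_one hα hirr L _ 0 1 (by decide),
      sum_kernRes_of_card_one hα hirr L _ 1 0 (by decide)]
    simp

lemma tendsto_sum_termThree {a b c L : ℝ} (ha : 0 < a) (hb : 0 < b) (hc : 0 < c) (hL : 0 ≤ L)
    (hab : ∀ k k' : ℤ, k * a = k' * b → k = 0 ∧ k' = 0)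
    (hac : ∀ k k' : ℤ, k * a = k' * c → k = 0 ∧ k' = 0)
    (hbc : ∀ k k' : ℤ, k * b = k' * c → k = 0 ∧ k' = 0)
    {P : ℕ} (hPa : L < P * a) (hPb : L < P * b) (hPc : L < P * c)
    {l : Filter ℝ} (hl : l ≤ atTop) {δ : ℝ} (hδ : 0 < δ)
    (hgap : ∀ᶠ R in l, ∀ n : ℤ, δ ≤ |R * a - n| ∧ δ ≤ |R * b - n| ∧ δ ≤ |R * c - n|) :
    Tendsto (fun R => ∑ k ∈ Finset.Icc 1 ⌊R * a⌋₊, termThree L a b c k +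
        ∑ k ∈ Finset.Icc 1 ⌊R * b⌋₊, termThree L b a c k +
        ∑ k ∈ Finset.Icc 1 ⌊R * c⌋₊, termThree L c a b k) l
      (𝓝 (∑ r ∈ Finset.range P, ∑ q ∈ Finset.range P, ∑ p ∈ Finset.range P,
        heavisideHalf (L - r * c - q * b - p * a) - residueThree a b c L)) := by
  obtain ⟨d, hd⟩ := tendsto_kern_three ha hb hc L
  have hα : ∀ i, 0 < ![a, b, c] i := fun i => by fin_cases i <;> simpa
  have hirr : ∀ i j : Fin 3, i ≠ j → ∀ k k' : ℤ, k * ![a, b, c] j = k' * ![a, b, c] i → k = 0 := by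
    intro i j hij k k' h
    fin_cases i <;> fin_cases j <;> simp at hij h
    · exact (hab k' k h.symm).2
    · exact (hac k' k h.symm).2
    · exact (hab k k' h).1
    · exact (hbc k' k h.symm).2
    · exact (hac k k' h).1
    · exact (hbc k k' h).1
  refine tendsto_residue_series hα hirr
    (by simp [Fin.sum_univ_three]; linarith) hd hl hδ ?_
    (tendsto_lineIntegral_kern_three ha hb hc hPa hPb hPc) fun R => ?_
  · filter_upwards [hgap] with R hR i
    fin_cases i
    · simpa using fun n => (hR n).1
    · simpa using fun n => (hR n).2.1
    · simpa using fun n => (hR n).2.2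
  · rw [Fin.sum_univ_three, sum_kernRes_of_card_two hα hirr L _ 0 1 2 (by decide) (by decide),
      sum_kernRes_of_card_two hα hirr L _ 1 0 2 (by decide) (by decide),
      sum_kernRes_of_card_two hα hirr L _ 2 0 1 (by decide) (by decide)]
    simp

/-! ### Existence of heights that avoid the poles -/

/-- The set of points of `[0, X]` at which `R a` is within `δ` of an integer has measure at most
`2 δ X + 4 δ / a`. -/
lemma volume_near_integer_le {a δ X : ℝ} (ha : 0 < a) (hδ : 0 < δ) (hδ1 : δ < 1) (hX : 0 ≤ X) :
    MeasureTheory.volume {R : ℝ | 0 ≤ R ∧ R ≤ X ∧ ∃ n : ℤ, |R * a - n| < δ} ≤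
      ENNReal.ofReal (2 * δ * X + 4 * δ / a) := by
  -- An integer within δ < 1 of Ra is below Xa + 1, hence at most ⌊Xa⌋ + 1; this accounts for the +
  -- 2 in the range.
  have hsub : {R : ℝ | 0 ≤ R ∧ R ≤ X ∧ ∃ n : ℤ, |R * a - n| < δ} ⊆
      ⋃ m ∈ Finset.range (⌊X * a⌋₊ + 2), Set.Icc (((m : ℝ) - δ) / a) (((m : ℝ) + δ) / a) := by
    rintro R ⟨h0, h1, n, hn⟩
    rw [abs_lt] at hn
    have hRa : 0 ≤ R * a := by positivity
    have hn0 : 0 ≤ n := by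
      have : (-1 : ℝ) < n := by linarith
      have : (-1 : ℤ) < n := by exact_mod_cast this
      omega
    lift n to ℕ using hn0
    rw [Int.cast_natCast] at hn
    simp only [Set.mem_iUnion, Finset.mem_range]
    refine ⟨n, ?_, ?_, ?_⟩
    · have h2 : (n : ℝ) < X * a + 1 := by
        have : R * a ≤ X * a := by gcongr
        linarith
      have h3 := Nat.lt_floor_add_one (X * a)
      have h4 : (n : ℝ) < ((⌊X * a⌋₊ + 2 : ℕ) : ℝ) := by push_cast; linarith
      exact_mod_cast h4
    · rw [div_le_iff₀ ha]; linarith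
    · rw [le_div_iff₀ ha]; linarith
  refine (MeasureTheory.measure_mono hsub).trans
    ((MeasureTheory.measure_biUnion_finset_le _ _).trans ?_)
  have e : ∀ m : ℕ, MeasureTheory.volume (Set.Icc (((m : ℝ) - δ) / a) (((m : ℝ) + δ) / a)) =
      ENNReal.ofReal (2 * δ / a) := by
    intro m
    rw [Real.volume_Icc]
    congr 1
    ring
  simp only [e, Finset.sum_const, Finset.card_range, nsmul_eq_mul]
  rw [← ENNReal.ofReal_natCast, ← ENNReal.ofReal_mul (by positivity)]
  refine ENNReal.ofReal_le_ofReal ?_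
  have h1 := Nat.floor_le (a := X * a) (by positivity)
  push_cast
  calc ((⌊X * a⌋₊ : ℝ) + 2) * (2 * δ / a) ≤ (X * a + 2) * (2 * δ / a) := by gcongr
    _ = _ := by field_simp; ring

/-- Each base excludes a set of density at most 2δ. The three together have density at most 6δ < 1
and cannot cover a long interval; this is where δ < 1/6 enters. -/
lemma exists_ge_forall_gap {a b c δ : ℝ} (ha : 0 < a) (hb : 0 < b) (hc : 0 < c) (hδ : 0 < δ)
    (hδ1 : δ < 1 / 6) (X₀ : ℝ) :
    ∃ R ≥ X₀, ∀ n : ℤ, δ ≤ |R * a - n| ∧ δ ≤ |R * b - n| ∧ δ ≤ |R * c - n| := by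
  by_contra! h
  set Y := max X₀ 0 with hY
  have hY0 : 0 ≤ Y := le_max_right _ _
  set S := 4 * δ / a + 4 * δ / b + 4 * δ / c with hS
  have hS0 : 0 ≤ S := by positivity
  -- With this choice X - Y = 6δX + S + 1, which exceeds the total measure 6δX + S of the excluded
  -- sets.
  set X := (Y + S + 1) / (1 - 6 * δ) with hXdef
  have h6 : 0 < 1 - 6 * δ := by linarith
  have hX : X * (1 - 6 * δ) = Y + S + 1 := by rw [hXdef]; field_simp
  have hX0 : 0 ≤ X := by positivity
  have hYX : Y ≤ X := by nlinarith
  let bad : ℝ → Set ℝ := fun a => {R : ℝ | 0 ≤ R ∧ R ≤ X ∧ ∃ n : ℤ, |R * a - n| < δ}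
  have hsub : Set.Icc Y X ⊆ bad a ∪ bad b ∪ bad c := by
    rintro R ⟨h1, h2⟩
    obtain ⟨n, hn⟩ := h R ((le_max_left _ _).trans h1)
    have hR : 0 ≤ R := hY0.trans h1
    by_cases hna : δ ≤ |R * a - n|
    · by_cases hnb : δ ≤ |R * b - n|
      · exact Or.inr ⟨hR, h2, n, hn hna hnb⟩
      · exact Or.inl (Or.inr ⟨hR, h2, n, not_le.1 hnb⟩)
    · exact Or.inl (Or.inl ⟨hR, h2, n, not_le.1 hna⟩)
  have hvol := (MeasureTheory.measure_mono (μ := MeasureTheory.volume) hsub).trans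
    ((MeasureTheory.measure_union_le _ _).trans
      (add_le_add (MeasureTheory.measure_union_le _ _) le_rfl))
  have hvol2 := hvol.trans (add_le_add (add_le_add
    (volume_near_integer_le ha hδ (by linarith) hX0)
    (volume_near_integer_le hb hδ (by linarith) hX0))
    (volume_near_integer_le hc hδ (by linarith) hX0))
  rw [Real.volume_Icc, ← ENNReal.ofReal_add (by positivity) (by positivity),
    ← ENNReal.ofReal_add (by positivity) (by positivity),
    ENNReal.ofReal_le_ofReal_iff (by positivity)] at hvol2
  nlinarith

lemma neBot_gapFilter {a b c : ℕ} (ha : 1 < a) (hb : 1 < b) (hc : 1 < c) {δ : ℝ} (hδ : 0 < δ)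
    (hδ1 : δ < 1 / 6) : (gapFilter a b c δ).NeBot := by
  refine Filter.frequently_iff_neBot.1 (Filter.frequently_atTop.2 fun X => ?_)
  have hlog : ∀ {n : ℕ}, 1 < n → 0 < Real.log n := fun h => Real.log_pos (by exact_mod_cast h)
  exact exists_ge_forall_gap (hlog ha) (hlog hb) (hlog hc) hδ hδ1 X

/-! ### Sums of Heaviside values as counting functions -/

open Classical in
lemma heavisideHalf_eq (y : ℝ) :
    heavisideHalf y = (if 0 ≤ y then 1 else 0) - 1 / 2 * (if y = 0 then 1 else 0) := by
  rw [heavisideHalf]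
  rcases lt_trichotomy y 0 with h | h | h
  · rw [if_neg (by linarith), if_neg h.ne, if_neg (by linarith), if_neg h.ne]; norm_num
  · rw [if_neg (by linarith), if_pos h, if_pos h.ge, if_pos h]; norm_num
  · rw [if_pos h, if_pos h.le, if_neg h.ne']; norm_num

/-- With y = L/a the sum is ⌊y⌋ + 1, less 1/2 if y is an integer. Subtracting y + 1/2 gives 1/2 -
{y}, or 0 for integral y: the half value at the jump is exactly the convention in B₁*. -/
lemma sum_heavisideHalf_eq {a L : ℝ} (ha : 0 < a) (hL : 0 ≤ L) {P : ℕ} (hP : L < P * a) :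
    ∑ p ∈ Finset.range P, heavisideHalf (L - p * a) - (L / a + 1 / 2) = -B1star (L / a) := by
  classical
  set y := L / a with hy
  have hy0 : 0 ≤ y := by positivity
  have hLy : L = y * a := by rw [hy]; field_simp
  have hyP : y < P := (div_lt_iff₀ ha).2 hP
  have h1 : ∀ p : ℕ, (0 ≤ L - p * a ↔ p ∈ Finset.range (⌊y⌋₊ + 1)) := by
    intro p
    rw [Finset.mem_range, Nat.lt_succ_iff, Nat.le_floor_iff hy0, sub_nonneg, hLy,
      mul_le_mul_iff_left₀ ha]
  have h2 : ∀ p : ℕ, (L - p * a = 0 ↔ y = p) := by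
    intro p
    rw [sub_eq_zero, hLy, mul_left_inj' ha.ne']
  have hfl : ⌊y⌋₊ < P := (Nat.floor_lt hy0).2 hyP
  have h3 : Finset.range (⌊y⌋₊ + 1) ⊆ Finset.range P := Finset.range_subset_range.2 hfl
  have e1 : ∑ p ∈ Finset.range P, (if 0 ≤ L - p * a then (1 : ℝ) else 0) = ⌊y⌋₊ + 1 := by
    simp only [h1]
    rw [Finset.sum_ite_mem, Finset.inter_eq_right.2 h3]
    simp
  simp only [heavisideHalf_eq, Finset.sum_sub_distrib, ← Finset.mul_sum, e1, h2]
  rw [B1star]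
  split_ifs with hint
  · obtain ⟨n, hn⟩ := hint
    have hn0 : 0 ≤ n := by
      rw [hn] at hy0
      exact_mod_cast hy0
    lift n to ℕ using hn0
    rw [Int.cast_natCast] at hn
    have e2 : ∑ p ∈ Finset.range P, (if y = p then (1 : ℝ) else 0) = 1 := by
      rw [Finset.sum_eq_single n]
      · rw [if_pos hn]
      · intro p _ hp
        rw [if_neg]
        rw [hn]
        exact fun h => hp (by exact_mod_cast h.symm)
      · intro h
        refine absurd (Finset.mem_range.2 ?_) h
        rw [hn] at hyP
        exact_mod_cast hyP
    rw [e2, hn, Nat.floor_natCast]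
    ring
  · have e2 : ∑ p ∈ Finset.range P, (if y = p then (1 : ℝ) else 0) = 0 :=
      Finset.sum_eq_zero fun p _ => if_neg fun h => hint ⟨p, by rw [h]; simp⟩
    rw [e2, ← Int.self_sub_floor, natCast_floor_eq_intCast_floor hy0]
    ring

/-- Passing to absolute values and exponentiating turns a linear relation between the logarithms
into a^{|k|} = b^{|k'|}. -/
lemma log_indep {a b : ℕ} (ha : 1 < a) (hb : 1 < b)
    (h : ∀ m n : ℕ, a ^ m = b ^ n → m = 0) (k k' : ℤ) (hk : k * Real.log a = k' * Real.log b) :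
    k = 0 ∧ k' = 0 := by
  have hla : 0 < Real.log a := Real.log_pos (by exact_mod_cast ha)
  have hlb : 0 < Real.log b := Real.log_pos (by exact_mod_cast hb)
  have h1 : (k.natAbs : ℝ) * Real.log a = k'.natAbs * Real.log b := by
    have := congrArg abs hk
    rw [abs_mul, abs_mul, abs_of_pos hla, abs_of_pos hlb] at this
    rwa [Nat.cast_natAbs, Nat.cast_natAbs, Int.cast_abs, Int.cast_abs]
  rw [← Real.log_pow, ← Real.log_pow] at h1
  have h2 := Real.log_injOn_pos (Set.mem_Ioi.2 (by positivity)) (Set.mem_Ioi.2 (by positivity)) h1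
  have h3 := h _ _ (by exact_mod_cast h2)
  have hk0 : k = 0 := Int.natAbs_eq_zero.1 h3
  refine ⟨hk0, ?_⟩
  rw [hk0, Int.cast_zero, zero_mul] at hk
  rcases mul_eq_zero.1 hk.symm with h4 | h4
  · exact_mod_cast h4
  · exact absurd h4 hlb.ne'

/-- A monomial m contributes 1 if m ≤ x, less 1/2 if m = x. Injectivity of the exponent map ensures
that at most one triple gives m = x, so the correction is χ/2. The bounds on `P` make the box
contain every triple with m ≤ x. -/
lemma sum_heavisideHalf_eq_countN {a b c : ℕ} (ha : 1 < a) (hb : 1 < b) (hc : 1 < c)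
    (hind : Function.Injective (fun t : ℕ × ℕ × ℕ => a ^ t.1 * b ^ t.2.1 * c ^ t.2.2))
    {x : ℝ} (hx : 1 ≤ x) {P : ℕ} (hPa : Real.log x < P * Real.log a)
    (hPb : Real.log x < P * Real.log b) (hPc : Real.log x < P * Real.log c) :
    ∑ r ∈ Finset.range P, ∑ q ∈ Finset.range P, ∑ p ∈ Finset.range P,
        heavisideHalf (Real.log x - r * Real.log c - q * Real.log b - p * Real.log a) =
      countN a b c x - 1 / 2 * chiS a b c x := by
  classical
  have hx0 : 0 < x := by linarith
  have hla : 0 < Real.log a := Real.log_pos (by exact_mod_cast ha)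
  have hlb : 0 < Real.log b := Real.log_pos (by exact_mod_cast hb)
  have hlc : 0 < Real.log c := Real.log_pos (by exact_mod_cast hc)
  set m : ℕ × ℕ × ℕ → ℝ := fun t => (a : ℝ) ^ t.1 * (b : ℝ) ^ t.2.1 * (c : ℝ) ^ t.2.2 with hm
  have hm0 : ∀ t, 0 < m t := fun t => by positivity
  have hlogm : ∀ t : ℕ × ℕ × ℕ, Real.log x - t.2.2 * Real.log c - t.2.1 * Real.log b -
      t.1 * Real.log a = Real.log x - Real.log (m t) := by
    intro t
    rw [hm]
    simp only
    rw [Real.log_mul (by positivity) (by positivity), Real.log_mul (by positivity) (by positivity),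
      Real.log_pow, Real.log_pow, Real.log_pow]
    ring
  set Q := Finset.range P ×ˢ Finset.range P ×ˢ Finset.range P with hQ
  have hmQ : ∀ t, m t ≤ x → t ∈ Q := by
    intro t ht
    have h1 : 0 ≤ Real.log x - Real.log (m t) :=
      sub_nonneg.2 (Real.log_le_log (hm0 t) ht)
    rw [← hlogm] at h1
    have h2 : 0 ≤ (t.1 : ℝ) * Real.log a := by positivity
    have h3 : 0 ≤ (t.2.1 : ℝ) * Real.log b := by positivity
    have h4 : 0 ≤ (t.2.2 : ℝ) * Real.log c := by positivity
    have lt : ∀ {n : ℕ} {y : ℝ}, 0 < y → (n : ℝ) * y < P * y → n ∈ Finset.range P :=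
      fun hy h => Finset.mem_range.2 (by exact_mod_cast lt_of_mul_lt_mul_right h hy.le)
    simp only [hQ, Finset.mem_product]
    exact ⟨lt hla (by linarith), lt hlb (by linarith), lt hlc (by linarith)⟩
  have e1 : ∑ r ∈ Finset.range P, ∑ q ∈ Finset.range P, ∑ p ∈ Finset.range P,
        heavisideHalf (Real.log x - r * Real.log c - q * Real.log b - p * Real.log a) =
      ∑ t ∈ Q, heavisideHalf (Real.log x - Real.log (m t)) := by
    simp only [← hlogm]
    rw [hQ, Finset.sum_product, Finset.sum_comm]
    simp only [Finset.sum_product]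
    rw [Finset.sum_comm (s := Finset.range P) (t := Finset.range P)
      (f := fun p q => ∑ r ∈ Finset.range P, heavisideHalf
        (Real.log x - r * Real.log c - q * Real.log b - p * Real.log a))]
    exact Finset.sum_congr rfl fun q _ => Finset.sum_comm
  have h0 : ∀ t, (0 ≤ Real.log x - Real.log (m t) ↔ m t ≤ x) := fun t => by
    rw [sub_nonneg, Real.log_le_log_iff (hm0 t) hx0]
  have h00 : ∀ t, (Real.log x - Real.log (m t) = 0 ↔ x = m t) := fun t => by
    rw [sub_eq_zero]
    exact ⟨fun h => Real.log_injOn_pos hx0 (hm0 t) h, fun h => by rw [h]⟩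
  have e2 : (countN a b c x : ℝ) = ∑ t ∈ Q, (if m t ≤ x then (1 : ℝ) else 0) := by
    have : {t : ℕ × ℕ × ℕ | (a : ℝ) ^ t.1 * (b : ℝ) ^ t.2.1 * (c : ℝ) ^ t.2.2 ≤ x} =
        (Q.filter fun t => m t ≤ x : Finset (ℕ × ℕ × ℕ)) := by
      ext t
      simp only [Set.mem_ofPred_eq, Finset.coe_filter]
      exact ⟨fun h => ⟨hmQ t h, h⟩, fun h => h.2⟩
    rw [countN, this, Set.ncard_coe_finset, Finset.sum_boole]
  have e3 : chiS a b c x = ∑ t ∈ Q, (if x = m t then (1 : ℝ) else 0) := by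
    rw [chiS]
    by_cases hS : x ∈ smoothSet a b c
    · rw [Set.indicator_of_mem hS]
      obtain ⟨p, q, l, hpql⟩ := hS
      rw [Finset.sum_eq_single (p, q, l)]
      · rw [if_pos hpql]
      · intro t _ ht
        refine if_neg fun h => ht (hind ?_)
        have : m t = m (p, q, l) := h.symm.trans hpql
        simp only [hm] at this
        exact_mod_cast this
      · intro h
        exact absurd (hmQ _ hpql.ge) h
    · rw [Set.indicator_of_notMem hS]
      exact (Finset.sum_eq_zero fun t _ => if_neg fun h => hS ⟨t.1, t.2.1, t.2.2, h⟩).symm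
  rw [e1, e2, e3]
  simp only [heavisideHalf_eq, Finset.sum_sub_distrib, ← Finset.mul_sum, h0, h00]

/-! ### The series of the theorem in terms of the residue series -/

/-- Termwise this is cos(A - B)/sin B = sin A + cos A cot B, with A = 2πk log x/log a and B = πk log
b/log a. -/
lemma cosSum_eq {a b : ℕ} (ha : 0 < Real.log a)
    (hab : ∀ k k' : ℤ, k * Real.log b = k' * Real.log a → k = 0) (x R : ℝ) :
    cosSum x a b R = 2 * Real.pi * ∑ k ∈ Finset.Icc 1 ⌊R * Real.log a⌋₊,
        termOne (Real.log x) (Real.log a) k -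
      2 * Real.pi * ∑ k ∈ Finset.Icc 1 ⌊R * Real.log a⌋₊,
        termTwo (Real.log x) (Real.log a) (Real.log b) k := by
  rw [cosSum, Finset.mul_sum, Finset.mul_sum, ← Finset.sum_sub_distrib]
  refine Finset.sum_congr rfl fun k hk => ?_
  have hk0 := natCast_pos_of_mem hk
  have hk2 : (k : ℝ) ≠ 0 := by exact_mod_cast hk0
  have hs := sin_ne_zero_of_indep ha hab (k := k) (by exact_mod_cast hk0)
  have hpi := Real.pi_ne_zero
  have e : 2 * Real.pi * k * ((Real.log x - 1 / 2 * Real.log b) / Real.log a) =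
      2 * Real.pi * k * (Real.log x / Real.log a) - Real.pi * k * Real.log b / Real.log a := by
    ring
  rw [Int.cast_natCast] at hs
  rw [e, Real.cos_sub, termOne, termTwo, cotRatio, Int.cast_natCast]
  field_simp
  ring

/-- With D = B - C one has sin(A + D) + sin(A - D) = 2 sin A cos(B - C). Division by sin B sin C
gives 2 sin A (1 + cot B cot C), and the two-base terms remove the cos A part of `termThree`. -/
lemma sinSum_eq {a b c : ℕ} (ha : 0 < Real.log a)
    (hab : ∀ k k' : ℤ, k * Real.log b = k' * Real.log a → k = 0)
    (hac : ∀ k k' : ℤ, k * Real.log c = k' * Real.log a → k = 0) (x R : ℝ) :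
    sinSum x a b c R = 4 * Real.pi * ∑ k ∈ Finset.Icc 1 ⌊R * Real.log a⌋₊,
        termTwo (Real.log x) (Real.log a) (Real.log b) k +
      4 * Real.pi * ∑ k ∈ Finset.Icc 1 ⌊R * Real.log a⌋₊,
        termTwo (Real.log x) (Real.log a) (Real.log c) k -
      8 * Real.pi * ∑ k ∈ Finset.Icc 1 ⌊R * Real.log a⌋₊,
        termThree (Real.log x) (Real.log a) (Real.log b) (Real.log c) k := by
  rw [sinSum, Finset.mul_sum, Finset.mul_sum, Finset.mul_sum, ← Finset.sum_add_distrib,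
    ← Finset.sum_sub_distrib]
  refine Finset.sum_congr rfl fun k hk => ?_
  have hk0 := natCast_pos_of_mem hk
  have hk2 : (k : ℝ) ≠ 0 := by exact_mod_cast hk0
  have hs := sin_ne_zero_of_indep ha hab (k := k) (by exact_mod_cast hk0)
  have hs' := sin_ne_zero_of_indep ha hac (k := k) (by exact_mod_cast hk0)
  have hpi := Real.pi_ne_zero
  rw [Int.cast_natCast] at hs hs'
  have e1 : 2 * Real.pi * k *
      ((Real.log x + 1 / 2 * Real.log b - 1 / 2 * Real.log c) / Real.log a) =
      2 * Real.pi * k * (Real.log x / Real.log a) +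
      (Real.pi * k * Real.log b / Real.log a - Real.pi * k * Real.log c / Real.log a) := by
    ring
  have e2 : 2 * Real.pi * k *
      ((Real.log x - 1 / 2 * Real.log b + 1 / 2 * Real.log c) / Real.log a) =
      2 * Real.pi * k * (Real.log x / Real.log a) -
      (Real.pi * k * Real.log b / Real.log a - Real.pi * k * Real.log c / Real.log a) := by
    ring
  rw [e1, e2, Real.sin_add, Real.sin_sub, Real.sin_sub, Real.sin_sub, Real.cos_sub, termTwo,
    termTwo, termThree, cotRatio, cotRatio, Int.cast_natCast]
  field_simp
  ring

end

/-! ### Assembly of the formula -/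

theorem theorem7 (a b c : ℕ) (hab : a < b) (hbc : b < c)
    (hgcd : Nat.gcd (Nat.gcd a b) c = 1)
    (hind : Function.Injective (fun t : ℕ × ℕ × ℕ => a ^ t.1 * b ^ t.2.1 * c ^ t.2.2))
    (x : ℝ) (hx : 1 ≤ x) :
    ∃ Cab Cbc Cac S : ℝ,
      (∀ δ : ℝ, 0 < δ → δ < 1 / 6 →
        (gapFilter a b c δ).NeBot ∧
        Tendsto (fun R : ℝ => cosPairSum x a b R) (gapFilter a b c δ) (𝓝 Cab) ∧
        Tendsto (fun R : ℝ => cosPairSum x b c R) (gapFilter a b c δ) (𝓝 Cbc) ∧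
        Tendsto (fun R : ℝ => cosPairSum x a c R) (gapFilter a b c δ) (𝓝 Cac) ∧
        Tendsto (fun R : ℝ => sinSum x a b c R + sinSum x b a c R + sinSum x c a b R)
          (gapFilter a b c δ) (𝓝 S)) ∧
      (countN a b c x : ℝ) =
        Real.log x ^ 3 / (6 * Real.log a * Real.log b * Real.log c)
        + Real.log x ^ 2 / (4 * Real.log a * Real.log b)
        + Real.log x ^ 2 / (4 * Real.log a * Real.log c)
        + Real.log x ^ 2 / (4 * Real.log b * Real.log c)
        + Real.log x / (4 * Real.log a)
        + Real.log x / (4 * Real.log b)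
        + Real.log x / (4 * Real.log c)
        + Real.log a * Real.log x / (12 * Real.log b * Real.log c)
        + Real.log b * Real.log x / (12 * Real.log a * Real.log c)
        + Real.log c * Real.log x / (12 * Real.log a * Real.log b)
        + Real.log a / (24 * Real.log b) + Real.log a / (24 * Real.log c)
        + Real.log b / (24 * Real.log a) + Real.log b / (24 * Real.log c)
        + Real.log c / (24 * Real.log a) + Real.log c / (24 * Real.log b)
        + 1 / 8
        - B1star (Real.log x / Real.log a)
        - B1star (Real.log x / Real.log b)
        - B1star (Real.log x / Real.log c)
        - 1 / (4 * Real.pi) * Cab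
        - 1 / (4 * Real.pi) * Cbc
        - 1 / (4 * Real.pi) * Cac
        - 1 / (8 * Real.pi) * S
        + 1 / 2 * chiS a b c x := by
  -- If a ≤ 1 then a¹ = a², contrary to injectivity.
  have ha : 1 < a := by
    by_contra h
    have h1 : a = 0 ∨ a = 1 := by omega
    rcases h1 with rfl | rfl
    · simpa using @hind (1, 0, 0) (2, 0, 0) (by simp)
    · simpa using @hind (1, 0, 0) (2, 0, 0) (by simp)
  have hb : 1 < b := by omega
  have hc : 1 < c := by omega
  have hla : 0 < Real.log a := Real.log_pos (by exact_mod_cast ha)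
  have hlb : 0 < Real.log b := Real.log_pos (by exact_mod_cast hb)
  have hlc : 0 < Real.log c := Real.log_pos (by exact_mod_cast hc)
  have iab := log_indep ha hb fun m n h => by
    simpa using congrArg Prod.fst (@hind (m, 0, 0) (0, n, 0) (by simpa using h))
  have iac := log_indep ha hc fun m n h => by
    simpa using congrArg Prod.fst (@hind (m, 0, 0) (0, 0, n) (by simpa using h))
  have ibc := log_indep hb hc fun m n h => by
    simpa using congrArg (fun t => t.2.1) (@hind (0, m, 0) (0, 0, n) (by simpa using h))
  have hL : 0 ≤ Real.log x := Real.log_nonneg hx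
  obtain ⟨P, hPa, hPb, hPc⟩ : ∃ P : ℕ, Real.log x < P * Real.log a ∧ Real.log x < P * Real.log b ∧
      Real.log x < P * Real.log c := by
    obtain ⟨P, hP⟩ := exists_nat_gt (max (Real.log x / Real.log a)
      (max (Real.log x / Real.log b) (Real.log x / Real.log c)))
    rw [max_lt_iff, max_lt_iff, div_lt_iff₀ hla, div_lt_iff₀ hlb, div_lt_iff₀ hlc] at hP
    exact ⟨P, hP.1, hP.2.1, hP.2.2⟩
  obtain ⟨Nab, hNab⟩ := exists_tendsto_sum_termTwo hla hlb hL iab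
  obtain ⟨Nac, hNac⟩ := exists_tendsto_sum_termTwo hla hlc hL iac
  obtain ⟨Nbc, hNbc⟩ := exists_tendsto_sum_termTwo hlb hlc hL ibc
  have hN := sum_heavisideHalf_eq_countN ha hb hc hind hx hPa hPb hPc
  set Ba := B1star (Real.log x / Real.log a)
  set Bb := B1star (Real.log x / Real.log b)
  set Bc := B1star (Real.log x / Real.log c)
  set N₃ := (countN a b c x : ℝ) - 1 / 2 * chiS a b c x -
    residueThree (Real.log a) (Real.log b) (Real.log c) (Real.log x) with hN₃
  have hpi := Real.pi_ne_zero
  -- These values are read off from `cosSum_eq` and `sinSum_eq`: the one-base series tend to -B₁*,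
  -- the pairs to `Nab`, `Nbc`, `Nac`, and the three-base series to `N₃`. None of them depends on δ.
  refine ⟨2 * Real.pi * (-Ba + -Bb - Nab), 2 * Real.pi * (-Bb + -Bc - Nbc),
    2 * Real.pi * (-Ba + -Bc - Nac), 4 * Real.pi * (Nab + Nac + Nbc) - 8 * Real.pi * N₃,
    fun δ hδ hδ1 => ?_, ?_⟩
  · have hl : gapFilter a b c δ ≤ atTop := inf_le_left
    have hgap : ∀ᶠ R in gapFilter a b c δ, ∀ n : ℤ, δ ≤ |R * Real.log a - n| ∧
        δ ≤ |R * Real.log b - n| ∧ δ ≤ |R * Real.log c - n| :=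
      (inf_le_right : gapFilter a b c δ ≤ 𝓟 _) (mem_principal_self _)
    have t1a := tendsto_sum_termOne hla hL hPa hl hδ (hgap.mono fun R h n => (h n).1)
    have t1b := tendsto_sum_termOne hlb hL hPb hl hδ (hgap.mono fun R h n => (h n).2.1)
    have t1c := tendsto_sum_termOne hlc hL hPc hl hδ (hgap.mono fun R h n => (h n).2.2)
    rw [sum_heavisideHalf_eq hla hL hPa] at t1a
    rw [sum_heavisideHalf_eq hlb hL hPb] at t1b
    rw [sum_heavisideHalf_eq hlc hL hPc] at t1c
    have t2ab := hNab _ δ hl hδ (hgap.mono fun R h n => ⟨(h n).1, (h n).2.1⟩)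
    have t2ac := hNac _ δ hl hδ (hgap.mono fun R h n => ⟨(h n).1, (h n).2.2⟩)
    have t2bc := hNbc _ δ hl hδ (hgap.mono fun R h n => ⟨(h n).2.1, (h n).2.2⟩)
    have t3 := tendsto_sum_termThree hla hlb hlc hL iab iac ibc hPa hPb hPc hl hδ hgap
    rw [hN, ← hN₃] at t3
    have jab : ∀ k k' : ℤ, k * Real.log b = k' * Real.log a → k = 0 :=
      fun k k' h => (iab k' k h.symm).2
    have jba : ∀ k k' : ℤ, k * Real.log a = k' * Real.log b → k = 0 := fun k k' h => (iab k k' h).1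
    have jac : ∀ k k' : ℤ, k * Real.log c = k' * Real.log a → k = 0 :=
      fun k k' h => (iac k' k h.symm).2
    have jca : ∀ k k' : ℤ, k * Real.log a = k' * Real.log c → k = 0 := fun k k' h => (iac k k' h).1
    have jbc : ∀ k k' : ℤ, k * Real.log c = k' * Real.log b → k = 0 :=
      fun k k' h => (ibc k' k h.symm).2
    have jcb : ∀ k k' : ℤ, k * Real.log b = k' * Real.log c → k = 0 := fun k k' h => (ibc k k' h).1
    refine ⟨neBot_gapFilter ha hb hc hδ hδ1, ?_, ?_, ?_, ?_⟩
    · refine (((t1a.add t1b).sub t2ab).const_mul (2 * Real.pi)).congr fun R => ?_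
      rw [cosPairSum, cosSum_eq hla jab, cosSum_eq hlb jba]
      ring
    · refine (((t1b.add t1c).sub t2bc).const_mul (2 * Real.pi)).congr fun R => ?_
      rw [cosPairSum, cosSum_eq hlb jbc, cosSum_eq hlc jcb]
      ring
    · refine (((t1a.add t1c).sub t2ac).const_mul (2 * Real.pi)).congr fun R => ?_
      rw [cosPairSum, cosSum_eq hla jac, cosSum_eq hlc jca]
      ring
    · refine ((((t2ab.add t2ac).add t2bc).const_mul (4 * Real.pi)).sub
        (t3.const_mul (8 * Real.pi))).congr fun R => ?_
      rw [sinSum_eq hla jab jac, sinSum_eq hlb jba jbc, sinSum_eq hlc jca jcb]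
      ring
  -- Each pair limit occurs with coefficient 1/2 from its C and -1/2 from D. Each B₁* value occurs
  -- in two of the C's, with total coefficient 1, against the explicit -B₁*. What remains is
  -- `residueThree` + `N₃` + χ/2.
  · have e : (countN a b c x : ℝ) =
        residueThree (Real.log a) (Real.log b) (Real.log c) (Real.log x) - Ba - Bb - Bc
        - 1 / (4 * Real.pi) * (2 * Real.pi * (-Ba + -Bb - Nab))
        - 1 / (4 * Real.pi) * (2 * Real.pi * (-Bb + -Bc - Nbc))
        - 1 / (4 * Real.pi) * (2 * Real.pi * (-Ba + -Bc - Nac))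
        - 1 / (8 * Real.pi) * (4 * Real.pi * (Nab + Nac + Nbc) - 8 * Real.pi * N₃)
        + 1 / 2 * chiS a b c x := by
      rw [hN₃]
      field_simp
      ring
    exact e
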